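/- **Setting.** Let $k\ge 1$, $m\ge 0$ be integers, let $\Sigma$ be a compact $k$-dimensional smooth manifold with (possibly empty) smooth boundary, let $g$ be a smooth Riemannian metric on $\Sigma$, and let $g_0$ be the Euclidean metric of $\mathbb{R}^m$. The notions below do not depend on the choice of $g$; "almost everywhere" and "ess sup" refer to the Riemannian measure. For a finite-dimensional real vector space $V$, let $P(V)$ be the manifold of positive definite symmetric bilinear forms on $V$ with the Riemannian metric $\langle X,Y\rangle_b=\operatorname{tr}(B^{-1}X^{\mathsf T}B^{-1}Y)$ (in Gram matrices), and let $d_P$ be its geodesic distance. Let $\mathcal{P}(\Sigma)$ be the set of (a.e. classes of) measurable fields $b$ with $b|_x\in P(T_x\Sigma)$ for almost every $x$ and $\operatorname{ess\,sup}_x d_P(b|_x,g|_x)<\infty$, with the distance $d_{\mathcal P}(b_1,b_2)=\operatorname{ess\,sup}_x d_P(b_1|_x,b_2|_x)$. Let $$\mathrm{Imm}(\Sigma;\mathbb{R}^m)=\{f\in W^{1,\infty}(\Sigma;\mathbb{R}^m) : f^\# g_0\in\mathcal{P}(\Sigma)\}$$ (elements of $W^{1,\infty}$ being identified with Lipschitz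 maps), with the distance $$d_{\mathrm{Imm}}(f_1,f_2)=\|f_1-f_2\|_{L^\infty}+d_{\mathcal P}(f_1^\# g_0,f_2^\# g_0)+\operatorname*{ess\,sup}_{x\in\Sigma}\ \sup_{0\ne u\in T_x\Sigma}\measuredangle\big(df_1|_x u,\,df_2|_x u\big).$$ Let $\mathrm{Imm}^\times(\Sigma;\mathbb{R}^m)$ be the set of $f\in\mathrm{Imm}(\Sigma;\mathbb{R}^m)$ with $f|_{\partial\Sigma}\in\mathrm{Imm}(\partial\Sigma;\mathbb{R}^m)$, with the distance $d^\times_{\mathrm{Imm}}(f_1,f_2)=d_{\mathrm{Imm}}(f_1,f_2)+d_{\mathrm{Imm}}(f_1|_{\partial\Sigma},f_2|_{\partial\Sigma})$. Let $\mathrm{Diff}(\Sigma)$ be the group of bi-Lipschitz homeomorphisms of $\Sigma$, acting on $\mathrm{Imm}^\times(\Sigma;\mathbb{R}^m)$ by $f\mapsto f\circ\varphi$, let $\mathrm{Shape}(\Sigma;\mathbb{R}^m)=\mathrm{Imm}^\times(\Sigma;\mathbb{R}^m)/\mathrm{Diff}(\Sigma)$ with canonical map $\Pi$, and let $$d_{\mathrm{Shape}}(\Pi(f_1),\Pi(f_2))=\inf_{\varphi\in\mathrm{Diff}(\Sigma)}d^\times_{\mathrm{Imm}}(f_1,f_2\circ\varphi).$$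 Let $\mathcal{F}(f)=\int_\Sigma \mathrm{vol}_{f^\# g_0}$ be the volume functional and let $(\Pi_\#\mathcal{F})(x)=\inf\{\mathcal{F}(f) : f\in \mathrm{Imm}^\times(\Sigma;\mathbb{R}^m),\ \Pi(f)=x\}$ be its variational pushforward along $\Pi$. **Statement.** The functional $\Pi_\#\mathcal{F}$ is real-valued. Its modulus of continuity $$\omega_{\Pi_\#\mathcal{F}}(x,t)=\sup\{|(\Pi_\#\mathcal{F})(y)-(\Pi_\#\mathcal{F})(x)| : y\in\mathrm{Shape}(\Sigma;\mathbb{R}^m),\ d_{\mathrm{Shape}}(x,y)\le t\}$$ satisfies, for all $x\in\mathrm{Shape}(\Sigma;\mathbb{R}^m)$ and all $t\ge 0$, $$\omega_{\Pi_\#\mathcal{F}}(x,t)\le(\Pi_\#\mathcal{F})(x)\,e^{\sqrt{k}\,t}\,\sqrt{k}\,t.$$ In particular, $\Pi_\#\mathcal{F}$ is locally Lipschitz with respect to $d_{\mathrm{Shape}}$: every $x$ is the centre of a $d_{\mathrm{Shape}}$-ball of positive radius on which $\Pi_\#\mathcal{F}$ is Lipschitz. -/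

import Mathlib

open Set MeasureTheory Topology
open scoped Manifold Bundle ContDiff ENNReal NNReal

noncomputable section

namespace ShapeSpace

/-! ### Variational pushforward and modulus of continuity -/

/-- The variational pushforward `(ψ_# F)(x) = inf {F y | ψ y = x}`, with `inf ∅ = ∞`. -/
def pushforward {Y X : Type*} (ψ : Y → X) (F : Y → EReal) (x : X) : EReal :=
  ⨅ y ∈ ψ ⁻¹' {x}, F y

/-- The modulus of continuity of `G` at `x` with respect to the distance `d`:
`ω_G(x, t) = sup {|G y - G x| | d(x, y) ≤ t}`. -/
def modulusOfContinuity {X : Type*} (d : X → X → ℝ≥0∞) (G : X → ℝ) (x : X) (t : ℝ≥0) : ℝ≥0∞ :=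
  ⨆ y ∈ {y : X | d x y ≤ t}, ENNReal.ofReal |G y - G x|

/-- Local Lipschitz continuity of `G` with respect to the distance `d`: every point is the centre
of a ball on which `G` is Lipschitz. -/
def IsLocallyLipschitz {X : Type*} (d : X → X → ℝ≥0∞) (G : X → ℝ) : Prop :=
  ∀ x : X, ∃ r : ℝ≥0∞, 0 < r ∧ ∃ K : ℝ≥0, ∀ y z : X, d x y < r → d x z < r →
    ENNReal.ofReal |G y - G z| ≤ K * d y z

/-! ### Inner products on a vector space and rays -/

section Linear

variable {V : Type*} [AddCommGroup V] [Module ℝ V]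

/-- `P(V)`: the positive definite symmetric bilinear forms on `V`. -/
def posForms (V : Type*) [AddCommGroup V] [Module ℝ V] : Set (LinearMap.BilinForm ℝ V) :=
  {b | (∀ u v, b u v = b v u) ∧ ∀ v, v ≠ 0 → 0 < b v v}

/-- The Gram matrix of a bilinear form with respect to a tuple of vectors. -/
def gram {ι : Type*} (e : ι → V) (b : LinearMap.BilinForm ℝ V) : Matrix ι ι ℝ :=
  Matrix.of fun i j => b (e i) (e j)

/-- The inner product `⟨X, Y⟩_b = tr (B⁻¹ Xᵀ B⁻¹ Y)` on bilinear forms that is induced by the inner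
product `b`, in terms of the Gram matrices `B`, `X`, `Y` with respect to some basis. -/
def gP {ι : Type*} [Fintype ι] [DecidableEq ι] (B X Y : Matrix ι ι ℝ) : ℝ :=
  (B⁻¹ * X.transpose * B⁻¹ * Y).trace

/-- The `C¹` curves `[0, 1] → P(V)` from `b` to `c`. -/
def curvesP (b c : LinearMap.BilinForm ℝ V) : Set (ℝ → LinearMap.BilinForm ℝ V) :=
  {γ | (∀ t ∈ Icc (0 : ℝ) 1, γ t ∈ posForms V) ∧
    (∀ u v : V, ContDiffOn ℝ 1 (fun t => γ t u v) (Icc 0 1)) ∧ γ 0 = b ∧ γ 1 = c}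

/-- The length of a curve in `P(V)` with respect to the Riemannian metric `gP`. The value does not
depend on the basis `e` in which the Gram matrices are formed. -/
def lengthP {ι : Type*} [Fintype ι] [DecidableEq ι] (e : Module.Basis ι ℝ V)
    (γ : ℝ → LinearMap.BilinForm ℝ V) : ℝ≥0∞ :=
  ∫⁻ t in Icc (0 : ℝ) 1,
    let X : Matrix ι ι ℝ :=
      Matrix.of fun i j => derivWithin (fun s => γ s (e i) (e j)) (Icc 0 1) t
    ENNReal.ofReal √(gP (gram e (γ t)) X X)

/-- The geodesic distance `d_P` of the Riemannian manifold `P(V)`, which does not depend on the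
basis `e` either; it is `∞` if one of the forms is not positive definite. -/
def dP {ι : Type*} [Fintype ι] [DecidableEq ι] (e : Module.Basis ι ℝ V)
    (b c : LinearMap.BilinForm ℝ V) : ℝ≥0∞ :=
  ⨅ γ ∈ curvesP b c, lengthP e γ

/-- The distance `d_∞` between the maps on rays induced by two injective linear maps:
the supremum of the angles between `A u` and `B u` over all nonzero `u`. -/
def dRay {F : Type*} [NormedAddCommGroup F] [InnerProductSpace ℝ F] (A B : V →ₗ[ℝ] F) : ℝ≥0∞ :=
  ⨆ u ∈ {u : V | u ≠ 0}, ENNReal.ofReal (InnerProductGeometry.angle (A u) (B u))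

end Linear

/-! ### Lipschitz immersions -/

section Manifold

variable {ι : Type*} [Fintype ι] [DecidableEq ι] {H : Type*} [TopologicalSpace H]
  (I : ModelWithCorners ℝ (EuclideanSpace ℝ ι) H)
  {M : Type*} [TopologicalSpace M] [ChartedSpace H M]

/-- Fields of bilinear forms on the tangent spaces. -/
abbrev FormField (M : Type*) [TopologicalSpace M] [ChartedSpace H M] : Type _ :=
  ∀ x : M, LinearMap.BilinForm ℝ (TangentSpace I x)

/-- The standard basis of the tangent space. -/
def tangentBasis (x : M) : Module.Basis ι ℝ (TangentSpace I x) :=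
  (EuclideanSpace.basisFun ι ℝ).toBasis

/-- The coordinate frame `∂₁, …, ∂_k` of the chart at `p`, at the point with coordinates `y`. -/
def chartFrame (p : M) (y : EuclideanSpace ℝ ι) (i : ι) :
    TangentSpace I ((extChartAt I p).symm y) :=
  mfderivWithin 𝓘(ℝ, EuclideanSpace ℝ ι) I (extChartAt I p).symm (range I) y
    (EuclideanSpace.single i (1 : ℝ) : EuclideanSpace ℝ ι)

/-- The Gram matrix `(b(∂ᵢ, ∂ⱼ))` of a field of bilinear forms in the chart at `p`. -/
def chartGram (b : FormField I M) (p : M) (y : EuclideanSpace ℝ ι) : Matrix ι ι ℝ :=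
  gram (chartFrame I p y) (b ((extChartAt I p).symm y))

variable [MeasurableSpace M]

/-- The measure `√(det (b(∂ᵢ, ∂ⱼ))) dy` on the domain of the chart at `p` (and zero outside). -/
def chartVol (b : FormField I M) (p : M) : Measure M :=
  ((volume.restrict (extChartAt I p).target).withDensity
    fun y => ENNReal.ofReal √(chartGram I b p y).det).map (extChartAt I p).symm

/-- The measure of the volume density `vol_b`. By the change of variables formula, the measures
`chartVol I b p` agree on overlaps of chart domains, and so their supremum is the measure whose
restriction to the domain of the chart at `p` is `chartVol I b p`, for every `p`. -/
def vol (b : FormField I M) : Measure M := ⨆ p : M, chartVol I b p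

/-- The distance `d_𝒫(b₁, b₂) = ess sup d_P(b₁|ₓ, b₂|ₓ)`, where `g` is a fixed Riemannian metric
(and the value does not depend on it). -/
def dForms (g b₁ b₂ : FormField I M) : ℝ≥0∞ :=
  essSup (fun x => dP (tangentBasis I x) (b₁ x) (b₂ x)) (vol I g)

/-- Membership in `𝒫(M)`: measurable fields of bilinear forms that are positive definite almost
everywhere and have finite distance to the Riemannian metric `g`. -/
def MemP (g b : FormField I M) : Prop :=
  (∀ (p : M) (i j : ι), AEMeasurable (fun y => chartGram I b p y i j)
      (volume.restrict (extChartAt I p).target)) ∧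
    (∀ᵐ x ∂vol I g, b x ∈ posForms (TangentSpace I x)) ∧ dForms I g b g < ⊤

/-- `W^{1,∞}(M; ℝᵐ)` for compact `M`, each class being represented by its continuous
representative: these are the maps that are Lipschitz in charts. -/
def MemW1Inf {m : ℕ} (f : M → EuclideanSpace ℝ (Fin m)) : Prop :=
  ∀ p : M, LocallyLipschitzOn (extChartAt I p).target (f ∘ (extChartAt I p).symm)

/-- The differential of an `ℝᵐ`-valued map. -/
def differential {m : ℕ} (f : M → EuclideanSpace ℝ (Fin m)) (x : M) :
    TangentSpace I x →ₗ[ℝ] EuclideanSpace ℝ (Fin m) :=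
  (mfderiv I 𝓘(ℝ, EuclideanSpace ℝ (Fin m)) f x).toLinearMap

/-- The pullback `f^# g₀` of the Euclidean metric `g₀` of `ℝᵐ`. -/
def pullbackEuclidean {m : ℕ} (f : M → EuclideanSpace ℝ (Fin m)) : FormField I M := fun x =>
  (innerₗ (EuclideanSpace ℝ (Fin m))).compl₁₂ (differential I f x) (differential I f x)

/-- The space `Imm(M; ℝᵐ)` of Lipschitz immersions of a compact manifold with Riemannian
metric `g`. -/
def Imm (g : FormField I M) (m : ℕ) : Set (M → EuclideanSpace ℝ (Fin m)) :=
  {f | MemW1Inf I f ∧ MemP I g (pullbackEuclidean I f)}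

/-- The distance `d_Imm`. -/
def dImm (g : FormField I M) {m : ℕ} (f₁ f₂ : M → EuclideanSpace ℝ (Fin m)) : ℝ≥0∞ :=
  eLpNorm (f₁ - f₂) ⊤ (vol I g) +
    dForms I g (pullbackEuclidean I f₁) (pullbackEuclidean I f₂) +
    essSup (fun x => dRay (differential I f₁ x) (differential I f₂ x)) (vol I g)

/-- The volume `∫_M vol_{f^# g₀}`. -/
def totalVolume {m : ℕ} (f : M → EuclideanSpace ℝ (Fin m)) : ℝ≥0∞ := vol I (pullbackEuclidean I f) univ

end Manifold

/-! ### The boundary of a manifold with boundary -/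

section Boundary

variable {k : ℕ} [NeZero k]

/-- The model space of the boundary: the hyperplane `{y₀ = 0}` of `ℝᵏ`. -/
abbrev BoundaryModel (k : ℕ) [NeZero k] : Type := EuclideanSpace ℝ {i : Fin k // i ≠ 0}

/-- The inclusion of the hyperplane `{y₀ = 0}` into the half space. -/
def hyperplaneIncl (y : BoundaryModel k) : EuclideanHalfSpace k :=
  ⟨WithLp.toLp 2 fun i => if h : i = 0 then 0 else y ⟨i, h⟩, by simp⟩

/-- The projection of the half space to the hyperplane `{y₀ = 0}`. -/
def hyperplaneProj (z : EuclideanHalfSpace k) : BoundaryModel k :=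
  WithLp.toLp 2 fun i => z.1 i.1

theorem continuous_hyperplaneIncl : Continuous (hyperplaneIncl (k := k)) := by
  refine Continuous.subtype_mk ((PiLp.continuous_toLp 2 _).comp ?_) _
  refine continuous_pi fun i => ?_
  by_cases h : i = 0
  · simp only [h, dite_true]; exact continuous_const
  · simp only [h, dite_false]; fun_prop

theorem continuous_hyperplaneProj : Continuous (hyperplaneProj (k := k)) := by
  refine (PiLp.continuous_toLp 2 _).comp (continuous_pi fun i => ?_)
  exact (PiLp.continuous_apply 2 _ i.1).comp continuous_subtype_val

theorem hyperplaneProj_incl (y : BoundaryModel k) : hyperplaneProj (hyperplaneIncl y) = y := by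
  ext i
  simp [hyperplaneProj, hyperplaneIncl, i.2]

theorem hyperplaneIncl_proj {z : EuclideanHalfSpace k} (hz : z.1 0 = 0) :
    hyperplaneIncl (hyperplaneProj z) = z := by
  ext i
  by_cases h : i = 0
  · subst h; simp [hyperplaneIncl, hz]
  · simp [hyperplaneProj, hyperplaneIncl, h]

variable {M : Type*} [TopologicalSpace M] [ChartedSpace (EuclideanHalfSpace k) M]
  [IsManifold (𝓡∂ k) ∞ M]

theorem mem_boundary_iff {e : OpenPartialHomeomorph M (EuclideanHalfSpace k)}
    (he : e ∈ atlas (EuclideanHalfSpace k) M) {x : M} (hx : x ∈ e.source) :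
    x ∈ (𝓡∂ k).boundary M ↔ (e x).1 0 = 0 := by
  rw [← ModelWithCorners.compl_interior, mem_compl_iff]
  have h := (𝓡∂ k).isInteriorPoint_iff_of_mem_atlas (n := ∞) (by simp) he hx
  have h2 : x ∈ (𝓡∂ k).interior M ↔ 0 < (e x).1 0 := by
    refine h.trans ⟨fun h3 => ?_, fun h3 => ?_⟩
    · have h4 := e.interior_extend_target_subset_interior_range h3
      rw [modelWithCornersEuclideanHalfSpace_toFun, range_euclideanHalfSpace, interior_halfSpace] at h4
      exact h4
    · refine e.mem_interior_extend_target (e.map_source hx) ?_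
      rw [modelWithCornersEuclideanHalfSpace_toFun, range_euclideanHalfSpace, interior_halfSpace]
      exact h3
  rw [h2, not_lt]
  exact ⟨fun h3 => le_antisymm h3 (e x).2, fun h3 => h3.le⟩

theorem chart_symm_mem_boundary (x : M) {y : BoundaryModel k}
    (hy : hyperplaneIncl y ∈ (chartAt (EuclideanHalfSpace k) x).target) :
    (chartAt (EuclideanHalfSpace k) x).symm (hyperplaneIncl y) ∈ (𝓡∂ k).boundary M := by
  rw [mem_boundary_iff (chart_mem_atlas _ x)
    ((chartAt (EuclideanHalfSpace k) x).map_target hy),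
    (chartAt (EuclideanHalfSpace k) x).right_inv hy]
  simp [hyperplaneIncl]

/-- The chart of the boundary at `x` that is induced by the chart of `M` at `x`. -/
def boundaryChart (x : (𝓡∂ k).boundary M) :
    OpenPartialHomeomorph ((𝓡∂ k).boundary M) (BoundaryModel k) where
  toFun q := hyperplaneProj (chartAt (EuclideanHalfSpace k) x.1 q.1)
  invFun y := by
    classical
    exact if h : (chartAt (EuclideanHalfSpace k) x.1).symm (hyperplaneIncl y) ∈
      (𝓡∂ k).boundary M then ⟨_, h⟩ else x
  source := {q | q.1 ∈ (chartAt (EuclideanHalfSpace k) x.1).source}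
  target := {y | hyperplaneIncl y ∈ (chartAt (EuclideanHalfSpace k) x.1).target}
  map_source' q hq := by
    have h0 := (mem_boundary_iff (chart_mem_atlas _ x.1) hq).1 q.2
    rw [mem_ofPred_eq, hyperplaneIncl_proj h0]
    exact (chartAt (EuclideanHalfSpace k) x.1).map_source hq
  map_target' y hy := by
    have h0 := chart_symm_mem_boundary x.1 hy
    rw [mem_ofPred_eq, dif_pos h0]
    exact (chartAt (EuclideanHalfSpace k) x.1).map_target hy
  left_inv' q hq := by
    have h0 := (mem_boundary_iff (chart_mem_atlas _ x.1) hq).1 q.2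
    have h1 : (chartAt (EuclideanHalfSpace k) x.1).symm
        (hyperplaneIncl (hyperplaneProj (chartAt (EuclideanHalfSpace k) x.1 q.1))) = q.1 := by
      rw [hyperplaneIncl_proj h0]
      exact (chartAt (EuclideanHalfSpace k) x.1).left_inv hq
    have h2 : (chartAt (EuclideanHalfSpace k) x.1).symm
        (hyperplaneIncl (hyperplaneProj (chartAt (EuclideanHalfSpace k) x.1 q.1))) ∈
          (𝓡∂ k).boundary M := by
      rw [h1]; exact q.2
    rw [dif_pos h2]
    exact Subtype.ext h1
  right_inv' y hy := by
    rw [dif_pos (chart_symm_mem_boundary x.1 hy)]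
    rw [(chartAt (EuclideanHalfSpace k) x.1).right_inv hy, hyperplaneProj_incl]
  open_source := (chartAt (EuclideanHalfSpace k) x.1).open_source.preimage continuous_subtype_val
  open_target := (chartAt (EuclideanHalfSpace k) x.1).open_target.preimage
    continuous_hyperplaneIncl
  continuousOn_toFun := continuous_hyperplaneProj.comp_continuousOn
    ((chartAt (EuclideanHalfSpace k) x.1).continuousOn.comp continuous_subtype_val.continuousOn
      fun _ hq => hq)
  continuousOn_invFun := by
    rw [Topology.IsInducing.subtypeVal.continuousOn_iff]
    refine ContinuousOn.congr ((chartAt (EuclideanHalfSpace k) x.1).continuousOn_symm.comp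
      continuous_hyperplaneIncl.continuousOn fun _ hy => hy) fun y hy => ?_
    simp only [Function.comp_apply]
    rw [dif_pos (chart_symm_mem_boundary x.1 hy)]

/-- The boundary of a `k`-dimensional manifold is a `(k - 1)`-dimensional manifold. -/
instance boundaryChartedSpace : ChartedSpace (BoundaryModel k) ((𝓡∂ k).boundary M) where
  atlas := range boundaryChart
  chartAt := boundaryChart
  mem_chart_source x := mem_chart_source (EuclideanHalfSpace k) x.1
  chart_mem_atlas x := mem_range_self x

end Boundary

/-! ### Shape space -/

section Shape

variable {k : ℕ} [NeZero k] {M : Type*} [TopologicalSpace M]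
  [ChartedSpace (EuclideanHalfSpace k) M] [IsManifold (𝓡∂ k) ∞ M]

/-- Smooth Riemannian metrics on the `k`-dimensional manifold with boundary `M`. -/
abbrev RiemMetric (k : ℕ) [NeZero k] (M : Type*) [TopologicalSpace M]
    [ChartedSpace (EuclideanHalfSpace k) M] [IsManifold (𝓡∂ k) ∞ M] : Type _ :=
  Bundle.ContMDiffRiemannianMetric (𝓡∂ k) ∞ (EuclideanSpace ℝ (Fin k))
    (fun x : M => TangentSpace (𝓡∂ k) x)

/-- A Riemannian metric as a field of bilinear forms. -/
def RiemMetric.form (g : RiemMetric k M) : FormField (𝓡∂ k) M := fun x =>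
  LinearMap.mk₂ ℝ (fun u v => g.inner x u v) (by simp) (by simp) (by simp) (by simp)

/-- The pullback `j^# g` of a Riemannian metric along the inclusion `j : ∂M → M`. -/
def RiemMetric.boundaryForm (g : RiemMetric k M) :
    FormField 𝓘(ℝ, BoundaryModel k) ((𝓡∂ k).boundary M) := fun x =>
  let dj : TangentSpace 𝓘(ℝ, BoundaryModel k) x →ₗ[ℝ] TangentSpace (𝓡∂ k) x.1 :=
    (mfderiv 𝓘(ℝ, BoundaryModel k) (𝓡∂ k)
      (Subtype.val : (𝓡∂ k).boundary M → M) x).toLinearMap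
  (g.form x.1).compl₁₂ dj dj

/-- The geodesic distance `d_g` (the infimum of the lengths of `C¹` curves; it is `∞` between
different components). -/
def RiemMetric.edist (g : RiemMetric k M) (x y : M) : ℝ≥0∞ :=
  letI : Bundle.RiemannianBundle (fun x : M => TangentSpace (𝓡∂ k) x) := ⟨g.toRiemannianMetric⟩
  Manifold.riemannianEDist (𝓡∂ k) x y

/-- The group `Diff(M)` of Lipschitz diffeomorphisms: the homeomorphisms `φ` such that both `φ` and
`φ⁻¹` are Lipschitz with respect to `d_g`. -/
def Diff (g : RiemMetric k M) : Subgroup (M ≃ₜ M) where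
  carrier := {φ | (∃ K : ℝ≥0, ∀ x y, g.edist (φ x) (φ y) ≤ K * g.edist x y) ∧
    ∃ K : ℝ≥0, ∀ x y, g.edist (φ.symm x) (φ.symm y) ≤ K * g.edist x y}
  one_mem' := ⟨⟨1, fun x y => by simp⟩, ⟨1, fun x y => by rw [ENNReal.coe_one, one_mul]; exact le_rfl⟩⟩
  inv_mem' h := ⟨h.2, h.1⟩
  mul_mem' := by
    rintro φ ψ ⟨⟨K, hK⟩, ⟨L, hL⟩⟩ ⟨⟨K', hK'⟩, ⟨L', hL'⟩⟩
    refine ⟨⟨K * K', fun x y => ?_⟩, ⟨L' * L, fun x y => ?_⟩⟩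
    · rw [ENNReal.coe_mul, mul_assoc]
      exact (hK (ψ x) (ψ y)).trans (mul_le_mul_right (hK' x y) _)
    · rw [ENNReal.coe_mul, mul_assoc]
      exact (hL' (φ.symm x) (φ.symm y)).trans (mul_le_mul_right (hL x y) _)

variable [MeasurableSpace M]

/-- The space `Imm^×(M; ℝᵐ)` of strong Lipschitz immersions: Lipschitz immersions whose restriction
to the boundary is a Lipschitz immersion. -/
def StrongImm (g : RiemMetric k M) (m : ℕ) : Set (M → EuclideanSpace ℝ (Fin m)) :=
  {f | f ∈ Imm (𝓡∂ k) g.form m ∧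
    (f ∘ Subtype.val : (𝓡∂ k).boundary M → EuclideanSpace ℝ (Fin m)) ∈
      Imm 𝓘(ℝ, BoundaryModel k) g.boundaryForm m}

/-- The graph distance `d_Imm^×`. -/
def dStrongImm (g : RiemMetric k M) {m : ℕ} (f₁ f₂ : M → EuclideanSpace ℝ (Fin m)) : ℝ≥0∞ :=
  dImm (𝓡∂ k) g.form f₁ f₂ +
    dImm 𝓘(ℝ, BoundaryModel k) g.boundaryForm
      (f₁ ∘ Subtype.val : (𝓡∂ k).boundary M → EuclideanSpace ℝ (Fin m)) (f₂ ∘ Subtype.val)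

/-- Two strong Lipschitz immersions are equivalent if `f₂ = f₁ ∘ φ` for some `φ ∈ Diff(M)`. -/
def reparametrization (g : RiemMetric k M) (m : ℕ) : Setoid (StrongImm g m) where
  r f₁ f₂ := ∃ φ ∈ Diff g, f₂.1 = f₁.1 ∘ φ
  iseqv :=
    { refl := fun f => ⟨1, one_mem _, rfl⟩
      symm := by
        rintro f₁ f₂ ⟨φ, hφ, h⟩
        refine ⟨φ⁻¹, inv_mem hφ, ?_⟩
        rw [h]
        funext x
        exact congrArg f₁.1 (φ.apply_symm_apply x).symm
      trans := by
        rintro f₁ f₂ f₃ ⟨φ, hφ, h⟩ ⟨ψ, hψ, h'⟩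
        exact ⟨φ * ψ, mul_mem hφ hψ, by rw [h', h]; rfl⟩ }

/-- The shape space `Shape(M; ℝᵐ) = Imm^×(M; ℝᵐ) / Diff(M)`. -/
def Shape (g : RiemMetric k M) (m : ℕ) : Type _ := Quotient (reparametrization g m)

/-- The canonical map `Π : Imm^×(M; ℝᵐ) → Shape(M; ℝᵐ)`. -/
def proj (g : RiemMetric k M) (m : ℕ) (f : StrongImm g m) : Shape g m :=
  Quotient.mk (reparametrization g m) f

/-- The quotient distance `d_Shape`: the infimum of `d_Imm^×(f₁, f₂)` over all representatives.
As `Diff(M)` acts by isometries, the representative `f₁` may be kept fixed, so that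
`d_Shape(Π f₁, Π f₂) = inf_φ d_Imm^×(f₁, f₂ ∘ φ)`. -/
def dShape (g : RiemMetric k M) (m : ℕ) (x y : Shape g m) : ℝ≥0∞ :=
  ⨅ f₁ ∈ proj g m ⁻¹' {x}, ⨅ f₂ ∈ proj g m ⁻¹' {y}, dStrongImm g f₁.1 f₂.1

/-- The volume functional `F(f) = ∫_M vol_{f^# g₀}` on strong Lipschitz immersions. -/
def volumeFunctional (g : RiemMetric k M) (m : ℕ) (f : StrongImm g m) : EReal :=
  (totalVolume (𝓡∂ k) f.1 : ℝ≥0∞)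

/-- The variational pushforward `Π_# F` of the volume functional to shape space. -/
def shapeVolume (g : RiemMetric k M) (m : ℕ) : Shape g m → EReal :=
  pushforward (proj g m) (volumeFunctional g m)

end Shape

end ShapeSpace

end

/-!
The volume of an immersion `f` is the total mass of the measure given in every chart by the density
`√det (f^# g₀ (∂ᵢ, ∂ⱼ)) dy`. Two facts about it give the theorem.

*Comparison of densities.* Along a `C¹` curve `γ` of inner products with Gram matrices `B`, Jacobi's
formula and the Cauchy-Schwarz inequality give
`|(log det B)'| = |tr (B⁻¹ B')| ≤ √k √(tr (B⁻¹ B' B⁻¹ B'))`,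
so that `|log det b - log det c| ≤ √k d_P(b, c)` (`enorm_log_det_sub_le`). Since `d_Imm^×` dominates
`d_Imm`, which dominates the distance `d_𝒫` of the pullback metrics, `d_Imm^×(f₁, f₂) < s` implies
that the volumes of `f₁` and `f₂` differ at most by the factor `exp (√k s / 2)`
(`totalVolume_le_of_dImm_lt`).

*Invariance.* The volume is finite, and `f ∘ φ` has the same volume as `f` for every bi-Lipschitz
homeomorphism `φ` (`totalVolume_lt_top`, `totalVolume_comp`). Consequently, the infimum in the
definition of `Π_# F` is taken over a single value, and the comparison of volumes descends to shape
space. Invariance is a local statement in charts. The Riemannian distance is locally equivalent to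
the Euclidean distance of the chart, so `φ` and `φ⁻¹` are locally Lipschitz in charts; by
Rademacher's theorem the chain rule holds almost everywhere, and the change of variables formula
applies (`setLIntegral_areaDensity_le`). That this includes points of the boundary requires no
invariance of domain: since `φ⁻¹` maps null sets to null sets, almost every point is mapped to an
interior point of the chart. It is enough to prove an inequality of measures, because `φ` may be
replaced by `φ⁻¹`, and because `vol` is a supremum over charts no compatibility between charts is
needed beforehand.

The estimate `|V(y) - V(x)| ≤ V(x) (exp (√k t / 2) - 1) ≤ V(x) exp (√k t) √k t` then bounds the
modulus of continuity, and it implies the local Lipschitz property.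
-/

namespace ShapeSpace

/-! ### Gram determinants and the distance on inner products -/

section LinearAlgebra

variable {ι : Type*} [Fintype ι] [DecidableEq ι]

/-- The Cauchy-Schwarz inequality `⟨B, X⟩_B² ≤ ⟨B, B⟩_B ⟨X, X⟩_B` for the inner product `gP`, as
`⟨B, X⟩_B = tr (B⁻¹ X)`. -/
theorem trace_inv_mul_sq_le {B X : Matrix ι ι ℝ} (hB : B.PosDef) (hX : X.transpose = X) :
    (B⁻¹ * X).trace ^ 2 ≤ Fintype.card ι * gP B X X := by
  -- If `B⁻¹ = Cᵀ C`, then `X` becomes the symmetric matrix `C X Cᵀ` in a `B`-orthonormal basis.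
  obtain ⟨C, hC⟩ : ∃ C : Matrix ι ι ℝ, B⁻¹ = C.transpose * C := by
    open scoped MatrixOrder in
    obtain ⟨C, hC⟩ := CStarAlgebra.nonneg_iff_eq_star_mul_self.1 hB.inv.posSemidef.nonneg
    refine ⟨C, ?_⟩
    rw [hC, Matrix.star_eq_conjTranspose, Matrix.conjTranspose_eq_transpose_of_trivial]
  have h1 : (B⁻¹ * X).trace = ∑ i, (C * X * C.transpose) i i := by
    rw [hC, Matrix.mul_assoc, Matrix.trace_mul_comm]; rfl
  have hsymm : (C * X * C.transpose).transpose = C * X * C.transpose := by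
    simp [Matrix.transpose_mul, hX, Matrix.mul_assoc]
  have h2 : gP B X X = ∑ i, ∑ j, (C * X * C.transpose) i j ^ 2 := by
    have : gP B X X = ((C * X * C.transpose) * (C * X * C.transpose)).trace := by
      rw [gP, hX, hC]
      rw [show C.transpose * C * X * (C.transpose * C) * X =
        C.transpose * (C * X * (C.transpose * C) * X) by simp [Matrix.mul_assoc],
        Matrix.trace_mul_comm]
      simp [Matrix.mul_assoc]
    rw [this, Matrix.trace]
    refine Finset.sum_congr rfl fun i _ => ?_
    rw [Matrix.diag_apply, Matrix.mul_apply]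
    refine Finset.sum_congr rfl fun j _ => ?_
    rw [sq, ← congrFun (congrFun hsymm j) i]; rfl
  rw [h1, h2]
  calc (∑ i, (C * X * C.transpose) i i) ^ 2
      ≤ Fintype.card ι * ∑ i, (C * X * C.transpose) i i ^ 2 := by
        simpa using sq_sum_le_card_mul_sum_sq (s := (Finset.univ : Finset ι))
          (f := fun i => (C * X * C.transpose) i i)
    _ ≤ _ := by
        gcongr with i
        exact Finset.single_le_sum (f := fun j => (C * X * C.transpose) i j ^ 2)
          (fun j _ => sq_nonneg _) (Finset.mem_univ i)

/-- Jacobi's formula for the derivative of a determinant. -/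
theorem hasDerivWithinAt_det {B : ℝ → Matrix ι ι ℝ} {X : Matrix ι ι ℝ} {s : Set ℝ} {t : ℝ}
    (h : ∀ i j, HasDerivWithinAt (fun r => B r i j) (X i j) s t) :
    HasDerivWithinAt (fun r => (B r).det) ((B t).adjugate * X).trace s t := by
  have h1 : HasDerivWithinAt (fun r => (B r).det)
      (∑ σ : Equiv.Perm ι, (Equiv.Perm.sign σ : ℝ) *
        ∑ i, (∏ j ∈ Finset.univ.erase i, B t (σ j) j) • X (σ i) i) s t := by
    simp_rw [Matrix.det_apply']
    refine HasDerivWithinAt.fun_sum fun σ _ => ?_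
    exact (HasDerivWithinAt.fun_finsetProd fun i _ => h (σ i) i).const_mul _
  convert h1 using 1
  rw [Matrix.trace]
  simp_rw [Finset.mul_sum]
  rw [Finset.sum_comm]
  refine Finset.sum_congr rfl fun i _ => ?_
  have : ((B t).adjugate * X).diag i = (Matrix.cramer (B t) fun j => X j i) i := by
    rw [Matrix.cramer_eq_adjugate_mulVec]; rfl
  rw [this, Matrix.cramer_apply, Matrix.det_apply']
  refine Finset.sum_congr rfl fun σ _ => ?_
  congr 1
  rw [← Finset.mul_prod_erase _ _ (Finset.mem_univ i), mul_comm, smul_eq_mul]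
  congr 1
  · refine Finset.prod_congr rfl fun j hj => ?_
    rw [Matrix.updateCol_ne (Finset.ne_of_mem_erase hj)]
  · simp

variable {V : Type*} [AddCommGroup V] [Module ℝ V]

theorem posDef_gram {κ : Type*} [Fintype κ] (e : Module.Basis κ ℝ V)
    {b : LinearMap.BilinForm ℝ V} (hb : b ∈ posForms V) :
    (gram e b).PosDef := by
  refine Matrix.PosDef.of_dotProduct_mulVec_pos ?_ fun x hx => ?_
  · ext i j; simp [gram, hb.1 (e j) (e i)]
  · have h := hb.2 (∑ i, x i • e i) fun h0 => hx <| funext fun i =>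
      (Fintype.linearIndependent_iff.1 e.linearIndependent) x h0 i
    have hsum : star x ⬝ᵥ (gram e b).mulVec x = b (∑ i, x i • e i) (∑ i, x i • e i) := ?_
    · rwa [hsum]
    simp only [gram, dotProduct, Matrix.mulVec, map_sum, LinearMap.sum_apply, map_smul,
      LinearMap.smul_apply, Finset.mul_sum, star_trivial, Matrix.of_apply, smul_eq_mul]
    rw [Finset.sum_comm]
    refine Finset.sum_congr rfl fun i _ => Finset.sum_congr rfl fun j _ => ?_
    ring

theorem det_gram_eq (e : Module.Basis ι ℝ V) (v : ι → V) (b : LinearMap.BilinForm ℝ V) :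
    (gram v b).det = (e.toMatrix v).det ^ 2 * (gram e b).det := by
  have : gram v b = (e.toMatrix v).transpose * gram e b * e.toMatrix v := by
    ext i j
    conv_lhs => rw [gram, Matrix.of_apply, ← e.sum_toMatrix_smul_self v i,
      ← e.sum_toMatrix_smul_self v j]
    simp only [gram, map_sum, LinearMap.sum_apply, map_smul, LinearMap.smul_apply, smul_eq_mul,
      Matrix.mul_apply, Matrix.transpose_apply, Matrix.of_apply, Finset.sum_mul, Finset.mul_sum]
    refine Finset.sum_congr rfl fun i _ => Finset.sum_congr rfl fun j _ => ?_
    ring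
  rw [this, Matrix.det_mul, Matrix.det_mul, Matrix.det_transpose]
  ring

/-- `log det` is `√k`-Lipschitz along curves of inner products. -/
theorem enorm_log_det_sub_le (e : Module.Basis ι ℝ V) {b c : LinearMap.BilinForm ℝ V}
    {γ : ℝ → LinearMap.BilinForm ℝ V} (hγ : γ ∈ curvesP b c) :
    ‖Real.log (gram e c).det - Real.log (gram e b).det‖ₑ ≤
      ENNReal.ofReal √(Fintype.card ι) * lengthP e γ := by
  obtain ⟨hpos, hsm, rfl, rfl⟩ := hγ
  have hdet : ∀ t ∈ Icc (0 : ℝ) 1, 0 < (gram e (γ t)).det := fun t ht =>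
    (posDef_gram e (hpos t ht)).det_pos
  have hC : ContDiffOn ℝ 1 (fun t => Real.log (gram e (γ t)).det) (Icc 0 1) := by
    refine ContDiffOn.log ?_ fun t ht => (hdet t ht).ne'
    simp_rw [Matrix.det_apply']
    refine ContDiffOn.sum fun σ _ => contDiffOn_const.mul (contDiffOn_prod fun i _ => ?_)
    exact hsm _ _
  refine (enorm_sub_le_lintegral_derivWithin_Icc_of_contDiffOn_Icc hC zero_le_one).trans ?_
  rw [lengthP, ← lintegral_const_mul' _ _ ENNReal.ofReal_ne_top]
  refine setLIntegral_mono' measurableSet_Icc fun t ht => ?_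
  have hU := uniqueDiffOn_Icc (zero_lt_one' ℝ) t ht
  set X : Matrix ι ι ℝ := Matrix.of fun i j => derivWithin (fun s => γ s (e i) (e j)) (Icc 0 1) t
    with hX
  have hder : ∀ i j, HasDerivWithinAt (fun r => gram e (γ r) i j) (X i j) (Icc 0 1) t :=
    fun i j => ((hsm (e i) (e j)).differentiableOn one_ne_zero t ht).hasDerivWithinAt
  have hXs : X.transpose = X := by
    ext i j
    simp only [hX, Matrix.transpose_apply, Matrix.of_apply]
    exact derivWithin_congr (fun r hr => (hpos r hr).1 _ _) ((hpos t ht).1 _ _)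
  have hlog : derivWithin (fun t => Real.log (gram e (γ t)).det) (Icc 0 1) t =
      ((gram e (γ t))⁻¹ * X).trace := by
    rw [((hasDerivWithinAt_det hder).log (hdet t ht).ne').derivWithin hU, Matrix.inv_def,
      Ring.inverse_eq_inv', Matrix.smul_mul, Matrix.trace_smul, smul_eq_mul, div_eq_inv_mul]
  rw [hlog, ← ENNReal.ofReal_mul (Real.sqrt_nonneg _), ← ofReal_norm, Real.norm_eq_abs,
    ← Real.sqrt_mul (Nat.cast_nonneg _), ← Real.sqrt_sq_eq_abs]
  exact ENNReal.ofReal_le_ofReal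
    (Real.sqrt_le_sqrt (trace_inv_mul_sq_le (posDef_gram e (hpos t ht)) hXs))

/-- The ratio of the Gram determinants of two inner products is controlled by their distance, with
respect to any tuple of vectors (not only a basis), since both determinants scale with the same
factor. -/
theorem det_gram_le_of_dP_lt (e : Module.Basis ι ℝ V) (v : ι → V) {b c : LinearMap.BilinForm ℝ V}
    {s : ℝ} (hs : dP e b c < ENNReal.ofReal s) :
    (gram v c).det ≤ Real.exp (√(Fintype.card ι) * s) * (gram v b).det ∧
      (gram v b).det ≤ Real.exp (√(Fintype.card ι) * s) * (gram v c).det := by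
  have hs0 : 0 ≤ s := by
    by_contra! h
    simp [ENNReal.ofReal_of_nonpos h.le] at hs
  simp only [dP, iInf_lt_iff] at hs
  obtain ⟨γ, hγ, hlen⟩ := hs
  have h := (enorm_log_det_sub_le e hγ).trans (mul_le_mul_right hlen.le _)
  rw [← ENNReal.ofReal_mul (Real.sqrt_nonneg _), ← ofReal_norm, Real.norm_eq_abs,
    ENNReal.ofReal_le_ofReal_iff (by positivity), abs_le] at h
  obtain ⟨hpos, -, rfl, rfl⟩ := hγ
  have hb := (posDef_gram e (hpos 0 (by simp))).det_pos
  have hc := (posDef_gram e (hpos 1 (by simp))).det_pos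
  rw [det_gram_eq e v, det_gram_eq e v (γ 0), mul_left_comm, mul_left_comm (Real.exp _)]
  constructor <;> refine mul_le_mul_of_nonneg_left ?_ (sq_nonneg _)
  · rw [← Real.log_le_log_iff hc (by positivity), Real.log_mul (Real.exp_ne_zero _) hb.ne',
      Real.log_exp]
    linarith
  · rw [← Real.log_le_log_iff hb (by positivity), Real.log_mul (Real.exp_ne_zero _) hc.ne',
      Real.log_exp]
    linarith

end LinearAlgebra

/-! ### Charts and the Riemannian distance -/

section RiemannianDistance

open Manifold Bundle

variable {E : Type*} [NormedAddCommGroup E] [NormedSpace ℝ E] {H : Type*} [TopologicalSpace H]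
  {I : ModelWithCorners ℝ E H} {M : Type*} [TopologicalSpace M] [ChartedSpace H M]
  [IsManifold I 1 M]

/-- Changes of charts are locally Lipschitz, also at boundary points. -/
theorem exists_edist_extChartAt_le (p : M) {x : M} (hx : x ∈ (extChartAt I p).source) (q : M)
    (hq : x ∈ (extChartAt I q).source) :
    ∃ C : ℝ≥0, ∃ U ∈ 𝓝 x, ∀ y ∈ U, ∀ z ∈ U,
      edist (extChartAt I q y) (extChartAt I q z) ≤
        C * edist (extChartAt I p y) (extChartAt I p z) := by
  have hy : extChartAt I p x ∈ ((extChartAt I p).symm ≫ extChartAt I q).source := by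
    rw [PartialEquiv.trans_source, PartialEquiv.symm_source]
    exact ⟨(extChartAt I p).map_source hx, by rwa [mem_preimage, (extChartAt I p).left_inv hx]⟩
  obtain ⟨C, t, ht, hC⟩ :=
    (contDiffWithinAt_ext_coord_change (n := 1) (I := I) q p hy).exists_lipschitzOnWith
      I.convex_range
  refine ⟨C, (extChartAt I p).source ∩ extChartAt I p ⁻¹' t,
    Filter.inter_mem (extChartAt_source_mem_nhds' hx) ?_, fun y hy z hz => ?_⟩
  · have h := (continuousAt_extChartAt' hx).tendsto
    have h2 : Filter.Tendsto (extChartAt I p) (𝓝 x) (𝓝[range I] (extChartAt I p x)) := by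
      refine tendsto_nhdsWithin_of_tendsto_nhds_of_eventually_within _ h
        (Filter.Eventually.of_forall fun y => ?_)
      rw [extChartAt_coe]
      exact mem_range_self _
    exact h2 ht
  · have h := hC hy.2 hz.2
    simpa only [Function.comp_apply, (extChartAt I p).left_inv hy.1,
      (extChartAt I p).left_inv hz.1] using h

variable [RiemannianBundle (fun x : M => TangentSpace I x)]
  [IsContinuousRiemannianBundle E (fun x : M => TangentSpace I x)]

attribute [local instance] normedAddCommGroupTangentSpaceVectorSpace
  normedSpaceTangentSpaceVectorSpace

theorem eventually_enorm_mfderivWithin_symm_extChartAt_apply_le (x : M) :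
    ∃ C : ℝ≥0, ∀ᶠ y in 𝓝[range I] (extChartAt I x x), ∀ v : TangentSpace 𝓘(ℝ, E) y,
      ‖mfderiv[range I] (extChartAt I x).symm y v‖ₑ ≤ C * ‖v‖ₑ := by
  obtain ⟨C, -, hC⟩ := eventually_enorm_mfderivWithin_symm_extChartAt_lt I x
  refine ⟨C, ?_⟩
  filter_upwards [hC] with y hy v
  refine le_trans ?_ (mul_le_mul_left hy.le _)
  apply ContinuousLinearMap.le_opENorm

theorem eventually_enorm_mfderiv_extChartAt_apply_le (x : M) :
    ∃ C : ℝ≥0, ∀ᶠ y in 𝓝 x, ∀ v : TangentSpace I y,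
      ‖mfderiv% (extChartAt I x) y v‖ₑ ≤ C * ‖v‖ₑ := by
  obtain ⟨C, -, hC⟩ := eventually_enorm_mfderiv_extChartAt_lt I x
  refine ⟨C, ?_⟩
  filter_upwards [hC] with y hy v
  refine le_trans ?_ (mul_le_mul_left hy.le _)
  apply ContinuousLinearMap.le_opENorm

/-- The inverse of a chart is Lipschitz on both variables near the base point of the chart: a
segment in the chart is mapped to a curve of controlled length. -/
theorem exists_riemannianEDist_le_edist_extChartAt_self (x : M) :
    ∃ C : ℝ≥0, ∃ U ∈ 𝓝 x, ∀ y ∈ U, ∀ z ∈ U,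
      riemannianEDist I y z ≤ C * edist (extChartAt I x y) (extChartAt I x z) := by
  obtain ⟨C, hC⟩ := eventually_enorm_mfderivWithin_symm_extChartAt_apply_le (I := I) x
  obtain ⟨r, r_pos, hr⟩ : ∃ r > 0,
      Metric.ball (extChartAt I x x) r ∩ range I ⊆ (extChartAt I x).target ∩
        {y | ∀ v : TangentSpace 𝓘(ℝ, E) y,
          ‖mfderiv[range I] (extChartAt I x).symm y v‖ₑ ≤ C * ‖v‖ₑ} :=
    Metric.mem_nhdsWithin_iff.1 (Filter.inter_mem (extChartAt_target_mem_nhdsWithin x) hC)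
  have A : (extChartAt I x) ⁻¹' (Metric.ball (extChartAt I x x) r ∩ range I) ∈ 𝓝 x := by
    apply extChartAt_preimage_mem_nhds_of_mem_nhdsWithin (by simp)
    rw [inter_comm]
    exact inter_mem_nhdsWithin _ (Metric.ball_mem_nhds _ r_pos)
  refine ⟨C, _, Filter.inter_mem A (chart_source_mem_nhds H x), fun y hy z hz => ?_⟩
  -- The segment between the two points stays in a convex set on which the derivative of the inverse
  -- chart is bounded.
  let η := ContinuousAffineMap.lineMap (R := ℝ) (extChartAt I x y) (extChartAt I x z)
  set γ := (extChartAt I x).symm ∘ η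
  have hη : Icc 0 1 ⊆ ⇑η ⁻¹' ((extChartAt I x).target ∩
        {y | ∀ v : TangentSpace 𝓘(ℝ, E) y,
          ‖mfderiv[range I] (extChartAt I x).symm y v‖ₑ ≤ C * ‖v‖ₑ}) := by
    simp only [← image_subset_iff, ContinuousAffineMap.coe_lineMap_eq,
     ← segment_eq_image_lineMap, η]
    exact (((convex_ball _ _).inter I.convex_range).segment_subset hy.1 hz.1).trans hr
  simp only [preimage_inter, subset_inter_iff] at hη
  have η_smooth : CMDiff[Icc 0 1] 1 η := by
    apply ContMDiff.contMDiffOn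
    rw [contMDiff_iff_contDiff]
    exact ContinuousAffineMap.contDiff _
  have : riemannianEDist I y z ≤ pathELength I γ 0 1 := by
    apply riemannianEDist_le_pathELength _ _ _ zero_le_one
    · exact (contMDiffOn_extChartAt_symm x).comp η_smooth hη.1
    · simp [γ, η, ContinuousAffineMap.coe_lineMap_eq, hy.2]
    · simp [γ, η, ContinuousAffineMap.coe_lineMap_eq, hz.2]
  apply this.trans
  rw [← lintegral_fderiv_lineMap_eq_edist, pathELength_eq_lintegral_mfderivWithin_Icc,
    ← lintegral_const_mul' _ _ ENNReal.coe_ne_top]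
  apply setLIntegral_mono' measurableSet_Icc (fun t ht ↦ ?_)
  have : mfderiv[Icc 0 1] γ t =
      (mfderiv[range I] (extChartAt I x).symm (η t)) ∘L (mfderiv[Icc 0 1] η t) := by
    apply mfderivWithin_comp
    · exact mdifferentiableWithinAt_extChartAt_symm (hη.1 ht)
    · exact η_smooth.mdifferentiableOn one_ne_zero t ht
    · exact hη.1.trans (preimage_mono (extChartAt_target_subset_range x))
    · rw [uniqueMDiffWithinAt_iff_uniqueDiffWithinAt]
      exact uniqueDiffOn_Icc zero_lt_one t ht
  have : mfderiv[Icc 0 1] γ t 1 =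
      (mfderiv[range I] (extChartAt I x).symm (η t)) (mfderiv[Icc 0 1] η t 1) := congr($this 1)
  rw [this]
  refine (hη.2 ht _).trans ?_
  gcongr
  · simp only [mfderivWithin_eq_fderivWithin]
    exact le_of_eq rfl

/-- A chart is Lipschitz for the Riemannian distance near its base point: curves that are almost as
short as the distance of two points near the base point cannot leave the domain where the derivative
of the chart is bounded. -/
theorem exists_edist_extChartAt_self_le_riemannianEDist [RegularSpace M] (x : M) :
    ∃ C : ℝ≥0, ∃ U ∈ 𝓝 x, ∀ y ∈ U, ∀ z ∈ U,
      edist (extChartAt I x y) (extChartAt I x z) ≤ C * riemannianEDist I y z := by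
  obtain ⟨C, hC⟩ := eventually_enorm_mfderiv_extChartAt_apply_le (I := I) x
  obtain ⟨c, c_pos, hc⟩ := setOfPred_riemannianEDist_lt_subset_nhds' I
    (Filter.inter_mem hC (chart_source_mem_nhds H x))
  -- Two points of the ball of radius `c / 4` are joined by a curve of length less than `c / 2`,
  -- which therefore stays in the ball of radius `c`.
  have hc4 : (0 : ℝ≥0∞) < c / 4 := ENNReal.div_pos c_pos.ne' (by simp)
  refine ⟨C, _, eventually_riemannianEDist_lt (I := I) x hc4, fun y hy z hz => ?_⟩
  have hyz : riemannianEDist I y z < c / 2 := by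
    refine (riemannianEDist_triangle (y := x)).trans_lt ?_
    rw [riemannianEDist_comm (x := y)]
    refine (ENNReal.add_lt_add hy hz).trans_le (le_of_eq ?_)
    rw [← ENNReal.add_halves (c / 2), ENNReal.div_eq_inv_mul, ENNReal.div_eq_inv_mul,
      ENNReal.div_eq_inv_mul, ← mul_assoc, ← ENNReal.mul_inv (by simp) (by simp)]
    norm_num
  have hL : riemannianEDist I y z ≠ ⊤ := (hyz.trans_le le_top).ne
  refine ENNReal.le_mul_of_forall_lt (Or.inr hL) (Or.inl ENNReal.coe_ne_top) fun C' hC' d' hd' => ?_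
  obtain ⟨γ, hγy, hγz, γ_smooth, hγ⟩ := exists_lt_of_riemannianEDist_lt (lt_min hd' hyz)
  have hmem : ∀ t ∈ Icc (0 : ℝ) 1, (∀ v : TangentSpace I (γ t),
      ‖mfderiv% (extChartAt I x) (γ t) v‖ₑ ≤ C * ‖v‖ₑ) ∧
      γ t ∈ (chartAt H x).source := fun t ht => by
    refine hc ?_
    calc riemannianEDist I x (γ t) ≤ riemannianEDist I x y + riemannianEDist I y (γ t) :=
          riemannianEDist_triangle
      _ ≤ riemannianEDist I x y + pathELength I γ 0 1 := by
          gcongr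
          exact (riemannianEDist_le_pathELength (γ_smooth.mono (Icc_subset_Icc_right ht.2)) hγy rfl
            ht.1).trans (pathELength_mono le_rfl ht.2)
      _ < c / 2 + c / 2 := ENNReal.add_lt_add
          (hy.trans_le (ENNReal.div_le_div_left (by norm_num) _)) (hγ.trans_le (min_le_right _ _))
      _ = c := ENNReal.add_halves c
  let γ' := extChartAt I x ∘ γ
  have hγ' : CMDiff[Icc 0 1] 1 γ' :=
    contMDiffOn_extChartAt.comp (I' := I) (t := (chartAt H x).source) γ_smooth
      fun t ht => (hmem t ht).2
  calc edist (extChartAt I x y) (extChartAt I x z) = ‖γ' 1 - γ' 0‖ₑ := by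
        rw [edist_comm, edist_eq_enorm_sub, ← hγy, ← hγz]; rfl
    _ ≤ ∫⁻ t in Icc 0 1, ‖derivWithin γ' (Icc 0 1) t‖ₑ := by
      apply enorm_sub_le_lintegral_derivWithin_Icc_of_contDiffOn_Icc _ zero_le_one
      rwa [← contMDiffOn_iff_contDiffOn]
    _ = ∫⁻ t in Icc 0 1, ‖mfderiv[Icc 0 1] γ' t 1‖ₑ := by
      simp_rw [← fderivWithin_derivWithin, mfderivWithin_eq_fderivWithin]
      rfl
    _ ≤ ∫⁻ t in Icc 0 1, C * ‖mfderiv[Icc 0 1] γ t 1‖ₑ := by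
      apply setLIntegral_mono' measurableSet_Icc (fun t ht ↦ ?_)
      have : mfderiv[Icc 0 1] γ' t =
          (mfderiv% (extChartAt I x) (γ t)) ∘L (mfderiv[Icc 0 1] γ t) := by
        apply mfderiv_comp_mfderivWithin
        · exact mdifferentiableAt_extChartAt (hmem t ht).2
        · exact γ_smooth.mdifferentiableOn one_ne_zero t ht
        · rw [uniqueMDiffWithinAt_iff_uniqueDiffWithinAt]
          exact uniqueDiffOn_Icc zero_lt_one _ ht
      have : mfderiv[Icc 0 1] γ' t 1 =
          (mfderiv% (extChartAt I x) (γ t)) (mfderiv[Icc 0 1] γ t 1) := congr($this 1)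
      rw [this]
      exact (hmem t ht).1 _
    _ = C * pathELength I γ 0 1 := by
      rw [lintegral_const_mul' _ _ ENNReal.coe_ne_top,
          pathELength_eq_lintegral_mfderivWithin_Icc]
    _ ≤ C' * d' := mul_le_mul' hC'.le (hγ.le.trans (min_le_left _ _))

theorem exists_riemannianEDist_le_edist_extChartAt (p : M) {x : M}
    (hx : x ∈ (extChartAt I p).source) :
    ∃ C : ℝ≥0, ∃ U ∈ 𝓝 x, ∀ y ∈ U, ∀ z ∈ U,
      riemannianEDist I y z ≤ C * edist (extChartAt I p y) (extChartAt I p z) := by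
  obtain ⟨C, U, hU, h⟩ := exists_riemannianEDist_le_edist_extChartAt_self (I := I) x
  obtain ⟨C', U', hU', h'⟩ := exists_edist_extChartAt_le p hx x (mem_extChartAt_source x)
  refine ⟨C * C', U ∩ U', Filter.inter_mem hU hU', fun y hy z hz => (h y hy.1 z hz.1).trans ?_⟩
  rw [ENNReal.coe_mul, mul_assoc]
  exact mul_le_mul_right (h' y hy.2 z hz.2) _

theorem exists_edist_extChartAt_le_riemannianEDist [RegularSpace M] (p : M) {x : M}
    (hx : x ∈ (extChartAt I p).source) :
    ∃ C : ℝ≥0, ∃ U ∈ 𝓝 x, ∀ y ∈ U, ∀ z ∈ U,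
      edist (extChartAt I p y) (extChartAt I p z) ≤ C * riemannianEDist I y z := by
  obtain ⟨C, U, hU, h⟩ := exists_edist_extChartAt_self_le_riemannianEDist (I := I) x
  obtain ⟨C', U', hU', h'⟩ := exists_edist_extChartAt_le x (mem_extChartAt_source x) p hx
  refine ⟨C' * C, U ∩ U', Filter.inter_mem hU hU', fun y hy z hz => (h' y hy.2 z hz.2).trans ?_⟩
  rw [ENNReal.coe_mul, mul_assoc]
  exact mul_le_mul_right (h y hy.1 z hz.1) _

end RiemannianDistance

/-! ### Change of variables for area densities of Lipschitz maps -/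

section AreaDensity

variable {ι : Type*} [Fintype ι] [DecidableEq ι] {F : Type*} [NormedAddCommGroup F]
  [InnerProductSpace ℝ F]

/-- Lipschitz maps preserve null sets, as volume is comparable to Hausdorff measure. -/
theorem _root_.LipschitzOnWith.volume_image_eq_zero {κ : Type*} [Fintype κ]
    {f : EuclideanSpace ℝ κ → EuclideanSpace ℝ κ}
    {K : ℝ≥0} {s t : Set (EuclideanSpace ℝ κ)} (hf : LipschitzOnWith K f s) (hts : t ⊆ s)
    (ht : volume t = 0) : volume (f '' t) = 0 := by
  have hd : Module.finrank ℝ (EuclideanSpace ℝ κ) = Fintype.card κ := finrank_euclideanSpace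
  have h1 : (Measure.hausdorffMeasure (Module.finrank ℝ (EuclideanSpace ℝ κ)) :
      Measure (EuclideanSpace ℝ κ)) t = 0 :=
    Measure.absolutelyContinuous_isAddHaarMeasure _ volume ht
  have h2 := (hf.mono hts).hausdorffMeasure_image_le
    (d := Module.finrank ℝ (EuclideanSpace ℝ κ)) (by positivity)
  rw [h1, mul_zero, nonpos_iff_eq_zero] at h2
  exact Measure.absolutelyContinuous_isAddHaarMeasure volume
    (Measure.hausdorffMeasure (Module.finrank ℝ (EuclideanSpace ℝ κ))) h2

/-- The Gram matrix of the partial derivatives of a map, i.e. the first fundamental form in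
coordinates. -/
noncomputable def fderivGram (f : EuclideanSpace ℝ ι → F) (y : EuclideanSpace ℝ ι) : Matrix ι ι ℝ :=
  Matrix.of fun i j => inner ℝ (fderiv ℝ f y (EuclideanSpace.single i 1))
    (fderiv ℝ f y (EuclideanSpace.single j 1))

/-- The area density `√det (Dfᵀ Df)` of a map `f` (with `fderiv ℝ f y = 0` where `f` is not
differentiable). -/
noncomputable def areaDensity (f : EuclideanSpace ℝ ι → F) (y : EuclideanSpace ℝ ι) : ℝ≥0∞ :=
  ENNReal.ofReal √(fderivGram f y).det

theorem areaDensity_comp {G : EuclideanSpace ℝ ι → F} {τ : EuclideanSpace ℝ ι → EuclideanSpace ℝ ι}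
    {y : EuclideanSpace ℝ ι} (hτ : DifferentiableAt ℝ τ y) (hG : DifferentiableAt ℝ G (τ y)) :
    areaDensity (G ∘ τ) y = ENNReal.ofReal |(fderiv ℝ τ y).det| * areaDensity G (τ y) := by
  let e : Module.Basis ι ℝ (EuclideanSpace ℝ ι) := (EuclideanSpace.basisFun ι ℝ).toBasis
  let D := fderiv ℝ G (τ y)
  let b : LinearMap.BilinForm ℝ (EuclideanSpace ℝ ι) :=
    (innerₗ F).compl₁₂ D.toLinearMap D.toLinearMap
  have h1 : fderivGram G (τ y) = gram e b := by
    ext i j; simp [fderivGram, gram, b, e, D]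
  have h2 : fderivGram (G ∘ τ) y =
      gram (fun i => fderiv ℝ τ y (EuclideanSpace.single i 1)) b := by
    ext i j
    simp [fderivGram, gram, b, D, fderiv_comp y hG hτ]
  have h3 : (e.toMatrix fun i => fderiv ℝ τ y (EuclideanSpace.single i 1)).det =
      (fderiv ℝ τ y).det := by
    rw [ContinuousLinearMap.det, ← LinearMap.det_toMatrix e]
    congr 1
  rw [areaDensity, areaDensity, h1, h2, det_gram_eq e, h3, Real.sqrt_mul (sq_nonneg _),
    Real.sqrt_sq_eq_abs, ENNReal.ofReal_mul (abs_nonneg _)]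

/-- The area of `G ∘ τ` over `B` is at most the area of `G` over `τ(B)`, for a bi-Lipschitz map `τ`
between sets `W` and `W'` that are open up to null sets. -/
theorem setLIntegral_areaDensity_le [FiniteDimensional ℝ F]
    {τ σ : EuclideanSpace ℝ ι → EuclideanSpace ℝ ι} {G G' : EuclideanSpace ℝ ι → F}
    {W W' B : Set (EuclideanSpace ℝ ι)} {K K' L : ℝ≥0}
    (hW : volume (W \ interior W) = 0) (hW' : volume (W' \ interior W') = 0)
    (hmaps : MapsTo τ W W') (hinv : LeftInvOn σ τ W)
    (hτ : LipschitzOnWith K τ W) (hσ : LipschitzOnWith K' σ W') (hG : LipschitzOnWith L G W')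
    (heq : EqOn G' (G ∘ τ) W) (hBW : B ⊆ W) (hB : MeasurableSet B) :
    ∫⁻ y in B, areaDensity G' y ≤ ∫⁻ z in τ '' B, areaDensity G z := by
  -- `N` is the set of points at which the chain rule may fail, and `T` the exceptional set of `G`.
  -- The set `τ⁻¹(T)` is null because it is contained in `σ(T)`, and `σ` is Lipschitz.
  set N : Set (EuclideanSpace ℝ ι) := {y | y ∈ B ∧ ¬ (y ∈ interior W ∧ τ y ∈ interior W' ∧
    DifferentiableAt ℝ τ y ∧ DifferentiableAt ℝ G (τ y))} with hN
  set T : Set (EuclideanSpace ℝ ι) :=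
    (W' \ interior W') ∪ {z | z ∈ W' ∧ ¬ DifferentiableWithinAt ℝ G W' z} with hT
  have hT0 : volume T = 0 := by
    refine measure_union_null hW' ?_
    simpa [ae_iff] using hG.ae_differentiableWithinAt_of_mem (μ := volume)
  have hT1 : volume (σ '' T) = 0 :=
    hσ.volume_image_eq_zero (union_subset sdiff_subset fun z hz => hz.1) hT0
  have hτ0 : volume {y | y ∈ W ∧ ¬ DifferentiableWithinAt ℝ τ W y} = 0 := by
    simpa [ae_iff] using hτ.ae_differentiableWithinAt_of_mem (μ := volume)
  have hN0 : volume N = 0 := by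
    refine measure_mono_null ?_ (measure_union_null (measure_union_null hW hT1) hτ0)
    rintro y ⟨hyB, hy⟩
    have hyW := hBW hyB
    by_contra hcon
    simp only [mem_union, not_or] at hcon
    obtain ⟨⟨h1, h2⟩, h3⟩ := hcon
    have h1' : y ∈ interior W := by_contra fun h => h1 ⟨hyW, h⟩
    have h2' : τ y ∉ T := fun h => h2 ⟨τ y, h, hinv hyW⟩
    have h3' : DifferentiableWithinAt ℝ τ W y := by_contra fun h => h3 ⟨hyW, h⟩
    simp only [hT, mem_union, not_or] at h2'
    have h4 : τ y ∈ interior W' := by_contra fun h => h2'.1 ⟨hmaps hyW, h⟩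
    have h5 : DifferentiableWithinAt ℝ G W' (τ y) := by_contra fun h => h2'.2 ⟨hmaps hyW, h⟩
    exact hy ⟨h1', h4, h3'.differentiableAt (mem_interior_iff_mem_nhds.1 h1'),
      h5.differentiableAt (mem_interior_iff_mem_nhds.1 h4)⟩
  set B' := B \ toMeasurable volume N with hB'
  have hB'm : MeasurableSet B' := hB.diff (measurableSet_toMeasurable _ _)
  have hgood : ∀ y ∈ B', y ∈ interior W ∧ τ y ∈ interior W' ∧
      DifferentiableAt ℝ τ y ∧ DifferentiableAt ℝ G (τ y) := fun y hy => by
    by_contra h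
    exact hy.2 (subset_toMeasurable _ _ ⟨hy.1, h⟩)
  have hae : B' =ᵐ[volume] B :=
    sdiff_null_ae_eq_self (by rw [measure_toMeasurable, hN0])
  calc ∫⁻ y in B, areaDensity G' y = ∫⁻ y in B', areaDensity G' y := (setLIntegral_congr hae).symm
    _ = ∫⁻ y in B', ENNReal.ofReal |(fderiv ℝ τ y).det| * areaDensity G (τ y) := by
      refine setLIntegral_congr_fun hB'm fun y hy => ?_
      obtain ⟨h1, h2, h3, h4⟩ := hgood y hy
      have : G' =ᶠ[𝓝 y] G ∘ τ :=
        Filter.mem_of_superset (mem_interior_iff_mem_nhds.1 h1) fun z hz => heq hz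
      rw [← areaDensity_comp h3 h4, areaDensity, areaDensity, fderivGram, fderivGram,
        this.fderiv_eq]
    _ = ∫⁻ z in τ '' B', areaDensity G z :=
      (lintegral_image_eq_lintegral_abs_det_fderiv_mul volume hB'm
        (fun y hy => (hgood y hy).2.2.1.hasFDerivAt.hasFDerivWithinAt)
        (hinv.injOn.mono (sdiff_subset.trans hBW)) _).symm
    _ ≤ ∫⁻ z in τ '' B, areaDensity G z :=
      lintegral_mono_set (image_mono sdiff_subset)

theorem areaDensity_le_of_lipschitzOnWith {G : EuclideanSpace ℝ ι → F}
    {W : Set (EuclideanSpace ℝ ι)} {L : ℝ≥0}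
    (hG : LipschitzOnWith L G W) {y : EuclideanSpace ℝ ι} (hy : y ∈ interior W) :
    areaDensity G y ≤
      ENNReal.ofReal √((Fintype.card ι).factorial • (L * L : ℝ) ^ Fintype.card ι) := by
  refine ENNReal.ofReal_le_ofReal (Real.sqrt_le_sqrt ?_)
  refine (le_abs_self _).trans ?_
  have hD : ‖fderiv ℝ G y‖ ≤ L :=
    norm_fderiv_le_of_lipschitzOn ℝ (mem_interior_iff_mem_nhds.1 hy) hG
  have hi : ∀ i, ‖fderiv ℝ G y (EuclideanSpace.single i 1)‖ ≤ L := fun i => by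
    refine ((fderiv ℝ G y).le_opNorm _).trans ?_
    simpa using hD
  refine Matrix.det_le (abv := AbsoluteValue.abs) fun i j => ?_
  refine (abs_real_inner_le_norm _ _).trans ?_
  exact mul_le_mul (hi i) (hi j) (norm_nonneg _) L.2

end AreaDensity

/-! ### Volume measures in charts -/

section ChartVolume

variable {ι : Type*} [Fintype ι] {H : Type*} [TopologicalSpace H]
  {I : ModelWithCorners ℝ (EuclideanSpace ℝ ι) H}
  {M : Type*} [TopologicalSpace M] [ChartedSpace H M]

theorem measurableSet_extChartAt_target (hI : MeasurableSet (range I)) (p : M) :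
    MeasurableSet (extChartAt I p).target := by
  rw [extChartAt_target]
  exact ((chartAt H p).open_target.preimage I.continuous_symm).measurableSet.inter hI

theorem measurableSet_target_inter_preimage [MeasurableSpace M] [BorelSpace M]
    (hI : MeasurableSet (range I)) (p : M) {A : Set M} (hA : MeasurableSet A) :
    MeasurableSet ((extChartAt I p).target ∩ (extChartAt I p).symm ⁻¹' A) := by
  have ht := measurableSet_extChartAt_target hI p
  have h := (continuousOn_iff_continuous_domRestrict.1
    (continuousOn_extChartAt_symm (I := I) p)).measurable hA
  have h2 := (MeasurableEmbedding.subtype_coe ht).measurableSet_image.2 h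
  convert h2 using 1
  ext y
  simp [and_comm]

/-- The chain rule for a map in a chart. It needs no differentiability: differentiability at a point
does not depend on the chart, and otherwise both derivatives are zero by convention. -/
theorem differential_comp_mfderivWithin [IsManifold I 1 M] {m : ℕ}
    (f : M → EuclideanSpace ℝ (Fin m)) (p : M)
    {y : EuclideanSpace ℝ ι} (hy : y ∈ interior (extChartAt I p).target) (v : EuclideanSpace ℝ ι) :
    differential I f ((extChartAt I p).symm y)
      (mfderivWithin 𝓘(ℝ, EuclideanSpace ℝ ι) I (extChartAt I p).symm (range I) y v) =
      fderiv ℝ (f ∘ (extChartAt I p).symm) y v := by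
  have hy' := interior_subset hy
  have hr : range I ∈ 𝓝 y := Filter.mem_of_superset (mem_interior_iff_mem_nhds.1 hy)
    (extChartAt_target_subset_range p)
  by_cases hf : MDifferentiableAt I 𝓘(ℝ, EuclideanSpace ℝ (Fin m)) f ((extChartAt I p).symm y)
  · have h := mfderiv_comp_mfderivWithin (I := 𝓘(ℝ, EuclideanSpace ℝ ι)) y hf
      (mdifferentiableWithinAt_extChartAt_symm hy')
      ((uniqueMDiffWithinAt_iff_uniqueDiffWithinAt).2 (uniqueDiffWithinAt_of_mem_nhds hr))
    rw [mfderivWithin_eq_fderivWithin, fderivWithin_of_mem_nhds hr] at h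
    rw [h]
    rfl
  · have hF : ¬ DifferentiableAt ℝ (f ∘ (extChartAt I p).symm) y := fun hF => hf <| by
      have hs := (extChartAt I p).map_target hy'
      have h1 : MDifferentiableAt I 𝓘(ℝ, EuclideanSpace ℝ (Fin m))
          ((f ∘ (extChartAt I p).symm) ∘ extChartAt I p) ((extChartAt I p).symm y) := by
        refine MDifferentiableAt.comp _ (I' := 𝓘(ℝ, EuclideanSpace ℝ ι)) ?_
          (mdifferentiableAt_extChartAt (by rwa [← extChartAt_source (I := I)]))
        rw [(extChartAt I p).right_inv hy']
        exact hF.mdifferentiableAt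
      refine h1.congr_of_eventuallyEq ?_
      filter_upwards [extChartAt_source_mem_nhds' hs] with x hx
      exact (congrArg f ((extChartAt I p).left_inv hx)).symm
    rw [differential, mfderiv_zero_of_not_mdifferentiableAt hf,
      fderiv_zero_of_not_differentiableAt hF]
    rfl

variable [DecidableEq ι]

theorem chartVol_apply [MeasurableSpace M] [BorelSpace M] (hI : MeasurableSet (range I))
    (b : FormField I M) (p : M) {A : Set M} (hA : MeasurableSet A) :
    chartVol I b p A = ∫⁻ y in (extChartAt I p).target ∩ (extChartAt I p).symm ⁻¹' A,
      ENNReal.ofReal √(chartGram I b p y).det := by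
  have ht := measurableSet_extChartAt_target hI p
  have hm : AEMeasurable (extChartAt I p).symm (volume.restrict (extChartAt I p).target) :=
    (continuousOn_extChartAt_symm p).aemeasurable ht
  rw [chartVol, Measure.map_apply_of_aemeasurable
    (hm.mono_ac (withDensity_absolutelyContinuous _ _)) hA, withDensity_apply',
    Measure.restrict_restrict' ht, inter_comm]

theorem chartGram_pullbackEuclidean [IsManifold I 1 M] {m : ℕ} (f : M → EuclideanSpace ℝ (Fin m))
    (p : M) {y : EuclideanSpace ℝ ι} (hy : y ∈ interior (extChartAt I p).target) :
    chartGram I (pullbackEuclidean I f) p y = fderivGram (f ∘ (extChartAt I p).symm) y := by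
  ext i j
  have h := differential_comp_mfderivWithin f p hy
  simp only [chartGram, gram, Matrix.of_apply, pullbackEuclidean, fderivGram,
    ← h, chartFrame]
  rfl

end ChartVolume

section HalfSpace

variable {k : ℕ} [NeZero k] {M : Type*} [TopologicalSpace M]
  [ChartedSpace (EuclideanHalfSpace k) M]

theorem measurableSet_range_halfSpace : MeasurableSet (range (𝓡∂ k)) := by
  rw [modelWithCornersEuclideanHalfSpace_toFun]
  exact (𝓡∂ k).isClosed_range.measurableSet

/-- The chart image of an open set is open up to a null set in the boundary hyperplane. -/
theorem volume_image_sdiff_interior (p : M) {N : Set M} (hN : IsOpen N)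
    (hNs : N ⊆ (extChartAt (𝓡∂ k) p).source) :
    volume (extChartAt (𝓡∂ k) p '' N \ interior (extChartAt (𝓡∂ k) p '' N)) = 0 := by
  let c₀ : EuclideanSpace ℝ (Fin k) →ₗ[ℝ] ℝ := (EuclideanSpace.proj (0 : Fin k)).toLinearMap
  have h0 : volume (LinearMap.ker c₀ : Set (EuclideanSpace ℝ (Fin k))) = 0 := by
    refine Measure.addHaar_submodule _ _ fun h => ?_
    have : c₀ (EuclideanSpace.single 0 1) = 0 := LinearMap.mem_ker.1 (h ▸ Submodule.mem_top)
    simp [c₀] at this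
  refine measure_mono_null ?_ h0
  rintro _ ⟨⟨x, hx, rfl⟩, hy⟩
  have hyr : 0 ≤ extChartAt (𝓡∂ k) p x 0 := (chartAt (EuclideanHalfSpace k) p x).2
  by_contra hne
  have hpos : 0 < extChartAt (𝓡∂ k) p x 0 := lt_of_le_of_ne hyr fun h => hne h.symm
  refine hy (mem_interior_iff_mem_nhds.2 (extChartAt_image_nhds_mem_nhds_of_mem_interior_range
    (hNs hx) ?_ (hN.mem_nhds hx)))
  rw [modelWithCornersEuclideanHalfSpace_toFun, range_euclideanHalfSpace, interior_halfSpace]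
  exact hpos

end HalfSpace

/-! ### Riemannian metrics in charts -/

section Metric

open Bundle Manifold

variable {k : ℕ} [NeZero k] {M : Type*} [TopologicalSpace M]
  [ChartedSpace (EuclideanHalfSpace k) M] [IsManifold (𝓡∂ k) ∞ M]

theorem RiemMetric.isContinuousRiemannianBundle (g : RiemMetric k M) :
    letI : RiemannianBundle (fun x : M => TangentSpace (𝓡∂ k) x) := ⟨g.toRiemannianMetric⟩
    IsContinuousRiemannianBundle (EuclideanSpace ℝ (Fin k))
      (fun x : M => TangentSpace (𝓡∂ k) x) := by
  let _ : RiemannianBundle (fun x : M => TangentSpace (𝓡∂ k) x) := ⟨g.toRiemannianMetric⟩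
  exact ⟨g.inner, g.contMDiff.continuous, fun _ _ _ => rfl⟩

theorem RiemMetric.exists_edist_le_edist_extChartAt (g : RiemMetric k M) (p : M) {x : M}
    (hx : x ∈ (extChartAt (𝓡∂ k) p).source) :
    ∃ C : ℝ≥0, ∃ U ∈ 𝓝 x, ∀ y ∈ U, ∀ z ∈ U,
      g.edist y z ≤ C * EDist.edist (extChartAt (𝓡∂ k) p y) (extChartAt (𝓡∂ k) p z) := by
  let _ : RiemannianBundle (fun x : M => TangentSpace (𝓡∂ k) x) := ⟨g.toRiemannianMetric⟩
  have := g.isContinuousRiemannianBundle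
  exact exists_riemannianEDist_le_edist_extChartAt p hx

theorem RiemMetric.exists_edist_extChartAt_le_edist [RegularSpace M] (g : RiemMetric k M) (p : M)
    {x : M} (hx : x ∈ (extChartAt (𝓡∂ k) p).source) :
    ∃ C : ℝ≥0, ∃ U ∈ 𝓝 x, ∀ y ∈ U, ∀ z ∈ U,
      EDist.edist (extChartAt (𝓡∂ k) p y) (extChartAt (𝓡∂ k) p z) ≤ C * g.edist y z := by
  let _ : RiemannianBundle (fun x : M => TangentSpace (𝓡∂ k) x) := ⟨g.toRiemannianMetric⟩
  have := g.isContinuousRiemannianBundle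
  exact exists_edist_extChartAt_le_riemannianEDist p hx

theorem RiemMetric.form_mem_posForms (g : RiemMetric k M) (x : M) :
    g.form x ∈ posForms (TangentSpace (𝓡∂ k) x) :=
  ⟨fun u v => g.symm x u v, fun v hv => g.pos x v hv⟩

theorem RiemMetric.det_chartGram_pos (g : RiemMetric k M) (p : M) {y : EuclideanSpace ℝ (Fin k)}
    (hy : y ∈ (extChartAt (𝓡∂ k) p).target) : 0 < (chartGram (𝓡∂ k) g.form p y).det := by
  obtain ⟨D, hD⟩ := isInvertible_mfderivWithin_extChartAt_symm hy
  let e := (EuclideanSpace.basisFun (Fin k) ℝ).toBasis.map D.toLinearEquiv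
  have he : ∀ i, e i = D (EuclideanSpace.single i (1 : ℝ) : EuclideanSpace ℝ (Fin k)) := fun i =>
    (Module.Basis.map_apply _ _ _).trans (congrArg D (by simp; rfl))
  have : chartGram (𝓡∂ k) g.form p y = gram e (g.form ((extChartAt (𝓡∂ k) p).symm y)) := by
    ext i j
    simp only [chartGram, chartFrame, ← hD, gram, Matrix.of_apply, he]
    rfl
  rw [this]
  exact (posDef_gram e (g.form_mem_posForms _)).det_pos

theorem RiemMetric.continuousOn_chartGram (g : RiemMetric k M) (p : M) (i j : Fin k) :
    ContinuousOn (fun y => chartGram (𝓡∂ k) g.form p y i j) (extChartAt (𝓡∂ k) p).target := by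
  let _ : RiemannianBundle (fun x : M => TangentSpace (𝓡∂ k) x) := ⟨g.toRiemannianMetric⟩
  have := g.isContinuousRiemannianBundle
  have hframe : ∀ i, ContinuousOn (fun y => (⟨(extChartAt (𝓡∂ k) p).symm y,
      chartFrame (𝓡∂ k) p y i⟩ : TangentBundle (𝓡∂ k) M)) (extChartAt (𝓡∂ k) p).target := by
    intro i
    have hu : UniqueMDiffOn 𝓘(ℝ, EuclideanSpace ℝ (Fin k)) (extChartAt (𝓡∂ k) p).target :=
      uniqueMDiffOn_iff_uniqueDiffOn.2 (uniqueDiffOn_extChartAt_target p)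
    have h := (contMDiffOn_extChartAt_symm (I := 𝓡∂ k) (n := 1) p).continuousOn_tangentMapWithin
      le_rfl hu
    have hc : Continuous fun y : EuclideanSpace ℝ (Fin k) =>
        (⟨y, EuclideanSpace.single i (1 : ℝ)⟩ :
          TangentBundle 𝓘(ℝ, EuclideanSpace ℝ (Fin k)) (EuclideanSpace ℝ (Fin k))) :=
      (tangentBundleModelSpaceHomeomorph 𝓘(ℝ, EuclideanSpace ℝ (Fin k))).symm.continuous.comp
        (continuous_id.prodMk continuous_const)
    refine (h.comp hc.continuousOn fun y hy => hy).congr fun y hy => ?_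
    simp only [Function.comp_apply, tangentMapWithin, chartFrame]
    rw [(mdifferentiableWithinAt_extChartAt_symm hy).mfderivWithin_mono (hu y hy)
      (extChartAt_target_subset_range p)]
  exact ContinuousOn.inner_bundle (hframe i) (hframe j)

/-- A property that holds almost everywhere on the manifold holds almost everywhere with respect to
Lebesgue measure in every chart, since the density of the volume is positive. -/
theorem RiemMetric.ae_extChartAt_of_ae_vol [MeasurableSpace M] [BorelSpace M] (g : RiemMetric k M)
    {P : M → Prop} (h : ∀ᵐ x ∂vol (𝓡∂ k) g.form, P x) (p : M) :
    ∀ᵐ y ∂volume.restrict (extChartAt (𝓡∂ k) p).target, P ((extChartAt (𝓡∂ k) p).symm y) := by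
  have ht : MeasurableSet (extChartAt (𝓡∂ k) p).target :=
    measurableSet_extChartAt_target measurableSet_range_halfSpace p
  have hm : AEMeasurable (extChartAt (𝓡∂ k) p).symm
      (volume.restrict (extChartAt (𝓡∂ k) p).target) :=
    (continuousOn_extChartAt_symm p).aemeasurable ht
  have h1 : ∀ᵐ x ∂chartVol (𝓡∂ k) g.form p, P x :=
    ae_mono (le_iSup (chartVol (𝓡∂ k) g.form) p) h
  have h2 := ae_of_ae_map (hm.mono_ac (withDensity_absolutelyContinuous _ _)) h1
  refine (withDensity_absolutelyContinuous' ?_ ?_).ae_le h2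
  · refine ContinuousOn.aemeasurable ?_ ht
    refine ENNReal.continuous_ofReal.comp_continuousOn (Real.continuous_sqrt.comp_continuousOn ?_)
    simp_rw [Matrix.det_apply']
    exact continuousOn_finsetSum _ fun σ _ => continuousOn_const.mul
      (continuousOn_finsetProd _ fun i _ => g.continuousOn_chartGram p _ _)
  · filter_upwards [ae_restrict_mem ht] with y hy
    exact (ENNReal.ofReal_pos.2 (Real.sqrt_pos.2 (g.det_chartGram_pos p hy))).ne'

end Metric

/-! ### Invariance, finiteness and comparison of the volume -/

section LocalComparison

/-- An inequality of measures may be checked locally on a set of full measure. -/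
theorem measure_le_of_locally_le {X : Type*} [TopologicalSpace X] [SecondCountableTopology X]
    [MeasurableSpace X] [OpensMeasurableSpace X] {μ ν : Measure X} {s : Set X} (hs : μ sᶜ = 0)
    (h : ∀ x ∈ s, ∃ U ∈ 𝓝 x, ∀ A ⊆ U, MeasurableSet A → μ A ≤ ν A) : μ ≤ ν := by
  choose! U hU hle using h
  obtain ⟨t, hts, htc, hcov⟩ := TopologicalSpace.countable_cover_nhdsWithin
    (s := s) (f := fun x => interior (U x))
    fun x hx => mem_nhdsWithin_of_mem_nhds (interior_mem_nhds.2 (hU x hx))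
  -- Countably many of the neighborhoods cover `s`; these are made disjoint.
  rcases t.eq_empty_or_nonempty with rfl | hne
  · have hs0 : s = ∅ := by simpa using hcov
    have : μ = 0 := by simpa [hs0] using hs
    rw [this]
    exact Measure.zero_le ν
  obtain ⟨u, rfl⟩ := htc.exists_eq_range hne
  set V : ℕ → Set X := fun n => interior (U (u n)) with hV
  have hVm : ∀ n, MeasurableSet (disjointed V n) :=
    MeasurableSet.disjointed fun n => isOpen_interior.measurableSet
  rw [biUnion_range] at hcov
  refine Measure.le_iff.2 fun A hA => ?_
  have hdisj : Pairwise (Function.onFun Disjoint fun n => A ∩ disjointed V n) := fun i j hij =>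
    (disjoint_disjointed V hij).mono inter_subset_right inter_subset_right
  calc μ A ≤ μ ((⋃ n, A ∩ disjointed V n) ∪ sᶜ) := by
        refine measure_mono fun x hx => ?_
        by_cases hxs : x ∈ s
        · left
          rw [← inter_iUnion, iUnion_disjointed]
          exact ⟨hx, hcov hxs⟩
        · exact Or.inr hxs
    _ ≤ μ (⋃ n, A ∩ disjointed V n) + μ sᶜ := measure_union_le _ _
    _ = ∑' n, μ (A ∩ disjointed V n) := by
        rw [hs, add_zero, measure_iUnion hdisj fun n => hA.inter (hVm n)]
    _ ≤ ∑' n, ν (A ∩ disjointed V n) := by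
        refine ENNReal.tsum_le_tsum fun n => hle _ (hts (mem_range_self n)) _ ?_ (hA.inter (hVm n))
        exact inter_subset_right.trans ((disjointed_subset V n).trans interior_subset)
    _ = ν (⋃ n, A ∩ disjointed V n) := (measure_iUnion hdisj fun n => hA.inter (hVm n)).symm
    _ ≤ ν A := measure_mono (iUnion_subset fun n => inter_subset_left)

variable {k : ℕ} [NeZero k] {M : Type*} [TopologicalSpace M]
  [ChartedSpace (EuclideanHalfSpace k) M] {m : ℕ}

theorem MemW1Inf.exists_lipschitzOnWith_image {f : M → EuclideanSpace ℝ (Fin m)}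
    (hf : MemW1Inf (𝓡∂ k) f) (q : M) {x : M} (hx : x ∈ (extChartAt (𝓡∂ k) q).source) :
    ∃ L : ℝ≥0, ∃ U ∈ 𝓝 x, ∀ N ⊆ U,
      LipschitzOnWith L (f ∘ (extChartAt (𝓡∂ k) q).symm) (extChartAt (𝓡∂ k) q '' N) := by
  obtain ⟨L, t, ht, hL⟩ := hf q ((extChartAt (𝓡∂ k) q).map_source hx)
  refine ⟨L, (extChartAt (𝓡∂ k) q).source ∩ extChartAt (𝓡∂ k) q ⁻¹' t,
    Filter.inter_mem (extChartAt_source_mem_nhds' hx) ?_, fun N hN => hL.mono ?_⟩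
  · refine (tendsto_nhdsWithin_of_tendsto_nhds_of_eventually_within _
      (continuousAt_extChartAt' hx).tendsto ?_) ht
    filter_upwards [extChartAt_source_mem_nhds' hx] with y hy
    exact (extChartAt (𝓡∂ k) q).map_source hy
  · rintro _ ⟨y, hy, rfl⟩
    exact (hN hy).2

variable [MeasurableSpace M] [BorelSpace M]

theorem chartVol_compl_source (b : FormField (𝓡∂ k) M) (p : M) :
    chartVol (𝓡∂ k) b p (extChartAt (𝓡∂ k) p).sourceᶜ = 0 := by
  rw [chartVol_apply measurableSet_range_halfSpace _ p
    (isOpen_extChartAt_source (I := 𝓡∂ k) p).measurableSet.compl]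
  have : (extChartAt (𝓡∂ k) p).target ∩
      (extChartAt (𝓡∂ k) p).symm ⁻¹' (extChartAt (𝓡∂ k) p).sourceᶜ = ∅ :=
    eq_empty_of_forall_notMem fun y hy => hy.2 ((extChartAt (𝓡∂ k) p).map_target hy.1)
  rw [this, Measure.restrict_empty, lintegral_zero_measure]

variable [IsManifold (𝓡∂ k) ∞ M]

theorem chartVol_pullbackEuclidean (f : M → EuclideanSpace ℝ (Fin m)) (p : M) {A : Set M}
    (hA : MeasurableSet A) (hAp : A ⊆ (extChartAt (𝓡∂ k) p).source) :
    chartVol (𝓡∂ k) (pullbackEuclidean (𝓡∂ k) f) p A =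
      ∫⁻ y in extChartAt (𝓡∂ k) p '' A, areaDensity (f ∘ (extChartAt (𝓡∂ k) p).symm) y := by
  have hB := measurableSet_target_inter_preimage (I := 𝓡∂ k) measurableSet_range_halfSpace p hA
  rw [chartVol_apply measurableSet_range_halfSpace _ p hA,
    (extChartAt (𝓡∂ k) p).image_eq_target_inter_inv_preimage hAp]
  refine setLIntegral_congr_fun_ae hB ?_
  have h0 := volume_image_sdiff_interior p (isOpen_extChartAt_source (I := 𝓡∂ k) p) subset_rfl
  rw [(extChartAt (𝓡∂ k) p).image_source_eq_target] at h0
  filter_upwards [measure_eq_zero_iff_ae_notMem.1 h0] with y hy hyB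
  have hyi : y ∈ interior (extChartAt (𝓡∂ k) p).target := by_contra fun h => hy ⟨hyB.1, h⟩
  rw [areaDensity, chartGram_pullbackEuclidean f p hyi]

variable [RegularSpace M]

/-- The local form of the invariance of the volume under bi-Lipschitz homeomorphisms. -/
theorem exists_nhds_chartVol_comp_le (g : RiemMetric k M) {φ : M ≃ₜ M} (hφ : φ ∈ Diff g)
    {f : M → EuclideanSpace ℝ (Fin m)} (hf : MemW1Inf (𝓡∂ k) f) {p q x : M}
    (hp : x ∈ (extChartAt (𝓡∂ k) p).source) (hq : φ x ∈ (extChartAt (𝓡∂ k) q).source) :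
    ∃ U ∈ 𝓝 x, ∀ A ⊆ U, MeasurableSet A →
      chartVol (𝓡∂ k) (pullbackEuclidean (𝓡∂ k) (f ∘ φ)) p A ≤
        chartVol (𝓡∂ k) (pullbackEuclidean (𝓡∂ k) f) q (φ '' A) := by
  obtain ⟨⟨K, hK⟩, K', hK'⟩ := hφ
  -- Near `x` and `φ x`, the distances in the charts are equivalent to the Riemannian distance, for
  -- which `φ` and its inverse are Lipschitz; `τ` and `σ` are `φ` and its inverse in charts.
  obtain ⟨C₁, U₁, hU₁, h₁⟩ := g.exists_edist_le_edist_extChartAt p hp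
  obtain ⟨C₂, U₂, hU₂, h₂⟩ := g.exists_edist_extChartAt_le_edist q hq
  obtain ⟨C₃, U₃, hU₃, h₃⟩ := g.exists_edist_le_edist_extChartAt q hq
  obtain ⟨C₄, U₄, hU₄, h₄⟩ := g.exists_edist_extChartAt_le_edist p hp
  obtain ⟨L, U₅, hU₅, h₅⟩ := hf.exists_lipschitzOnWith_image q hq
  set N : Set M := interior ((U₁ ∩ U₄ ∩ (extChartAt (𝓡∂ k) p).source) ∩
    φ ⁻¹' (U₂ ∩ U₃ ∩ U₅ ∩ (extChartAt (𝓡∂ k) q).source)) with hN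
  have hNx : N ∈ 𝓝 x := interior_mem_nhds.2 <| Filter.inter_mem
    (Filter.inter_mem (Filter.inter_mem hU₁ hU₄) (extChartAt_source_mem_nhds' hp))
    (φ.continuous.continuousAt.preimage_mem_nhds (Filter.inter_mem (Filter.inter_mem
      (Filter.inter_mem hU₂ hU₃) hU₅) (extChartAt_source_mem_nhds' hq)))
  have hNp : N ⊆ (extChartAt (𝓡∂ k) p).source := fun y hy => (interior_subset hy).1.2
  have hNq : φ '' N ⊆ (extChartAt (𝓡∂ k) q).source := by
    rintro _ ⟨y, hy, rfl⟩
    exact (interior_subset hy).2.2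
  refine ⟨N, hNx, fun A hAN hA => ?_⟩
  set τ := extChartAt (𝓡∂ k) q ∘ φ ∘ (extChartAt (𝓡∂ k) p).symm with hτ
  set σ := extChartAt (𝓡∂ k) p ∘ φ.symm ∘ (extChartAt (𝓡∂ k) q).symm with hσ
  have hτx : ∀ y ∈ N, τ (extChartAt (𝓡∂ k) p y) = extChartAt (𝓡∂ k) q (φ y) := fun y hy => by
    simp only [hτ, Function.comp_apply, (extChartAt (𝓡∂ k) p).left_inv (hNp hy)]
  have hσx : ∀ y ∈ N, σ (extChartAt (𝓡∂ k) q (φ y)) = extChartAt (𝓡∂ k) p y := fun y hy => by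
    simp only [hσ, Function.comp_apply,
      (extChartAt (𝓡∂ k) q).left_inv (hNq (mem_image_of_mem φ hy)), φ.symm_apply_apply]
  have hτA : τ '' (extChartAt (𝓡∂ k) p '' A) = extChartAt (𝓡∂ k) q '' (φ '' A) := by
    rw [image_image, image_image]
    exact image_congr fun y hy => hτx y (hAN hy)
  rw [chartVol_pullbackEuclidean _ p hA (hAN.trans hNp),
    chartVol_pullbackEuclidean f q (φ.measurableEmbedding.measurableSet_image.2 hA)
      ((image_mono hAN).trans hNq), ← hτA]
  have hAm : MeasurableSet (extChartAt (𝓡∂ k) p '' A) := by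
    rw [(extChartAt (𝓡∂ k) p).image_eq_target_inter_inv_preimage (hAN.trans hNp)]
    exact measurableSet_target_inter_preimage measurableSet_range_halfSpace p hA
  refine setLIntegral_areaDensity_le (W := extChartAt (𝓡∂ k) p '' N)
    (W' := extChartAt (𝓡∂ k) q '' (φ '' N)) (σ := σ) (K := C₂ * (K * C₁)) (K' := C₄ * (K' * C₃))
    (L := L) (volume_image_sdiff_interior p isOpen_interior hNp)
    (volume_image_sdiff_interior q (φ.isOpenMap _ isOpen_interior) hNq) ?_ ?_ ?_ ?_ ?_ ?_
    (image_mono hAN) hAm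
  · rintro _ ⟨y, hy, rfl⟩
    exact ⟨φ y, mem_image_of_mem φ hy, (hτx y hy).symm⟩
  · rintro _ ⟨y, hy, rfl⟩
    rw [hτx y hy, hσx y hy]
  · rintro _ ⟨y, hy, rfl⟩ _ ⟨z, hz, rfl⟩
    rw [hτx y hy, hτx z hz, ENNReal.coe_mul, ENNReal.coe_mul, mul_assoc, mul_assoc]
    have hy' := interior_subset hy
    have hz' := interior_subset hz
    refine (h₂ _ hy'.2.1.1.1 _ hz'.2.1.1.1).trans (mul_le_mul_right ?_ _)
    exact (hK y z).trans (mul_le_mul_right (h₁ _ hy'.1.1.1 _ hz'.1.1.1) _)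
  · rintro _ ⟨_, ⟨y, hy, rfl⟩, rfl⟩ _ ⟨_, ⟨z, hz, rfl⟩, rfl⟩
    rw [hσx y hy, hσx z hz, ENNReal.coe_mul, ENNReal.coe_mul, mul_assoc, mul_assoc]
    have hy' := interior_subset hy
    have hz' := interior_subset hz
    refine (h₄ _ hy'.1.1.2 _ hz'.1.1.2).trans (mul_le_mul_right ?_ _)
    have h := hK' (φ y) (φ z)
    rw [φ.symm_apply_apply, φ.symm_apply_apply] at h
    exact h.trans (mul_le_mul_right (h₃ _ hy'.2.1.1.2 _ hz'.2.1.1.2) _)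
  · refine h₅ _ ?_
    rintro _ ⟨y, hy, rfl⟩
    exact (interior_subset hy).2.1.2
  · rintro _ ⟨y, hy, rfl⟩
    simp only [hτ, Function.comp_apply, (extChartAt (𝓡∂ k) p).left_inv (hNp hy),
      (extChartAt (𝓡∂ k) q).left_inv (hNq (mem_image_of_mem φ hy))]

theorem vol_comp_le [SecondCountableTopology M] (g : RiemMetric k M) {φ : M ≃ₜ M}
    (hφ : φ ∈ Diff g) {f : M → EuclideanSpace ℝ (Fin m)} (hf : MemW1Inf (𝓡∂ k) f) :
    vol (𝓡∂ k) (pullbackEuclidean (𝓡∂ k) (f ∘ φ)) ≤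
      (vol (𝓡∂ k) (pullbackEuclidean (𝓡∂ k) f)).map φ.symm := by
  refine iSup_le fun p => measure_le_of_locally_le (chartVol_compl_source _ p) fun x hx => ?_
  obtain ⟨U, hU, hle⟩ :=
    exists_nhds_chartVol_comp_le g hφ hf hx (mem_extChartAt_source (I := 𝓡∂ k) (φ x))
  refine ⟨U, hU, fun A hAU hA => (hle A hAU hA).trans ?_⟩
  rw [Measure.map_apply φ.symm.measurable hA, ← φ.image_eq_preimage_symm]
  exact Measure.le_iff'.1 (le_iSup (chartVol (𝓡∂ k) (pullbackEuclidean (𝓡∂ k) f)) (φ x)) _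

/-- The volume of a Lipschitz map is invariant under reparametrization. -/
theorem totalVolume_comp [SecondCountableTopology M] (g : RiemMetric k M) {φ : M ≃ₜ M}
    (hφ : φ ∈ Diff g) {f : M → EuclideanSpace ℝ (Fin m)} (hf : MemW1Inf (𝓡∂ k) f)
    (hfφ : MemW1Inf (𝓡∂ k) (f ∘ φ)) :
    totalVolume (𝓡∂ k) (f ∘ φ) = totalVolume (𝓡∂ k) f := by
  have key : ∀ {φ : M ≃ₜ M} {f : M → EuclideanSpace ℝ (Fin m)}, φ ∈ Diff g →
      MemW1Inf (𝓡∂ k) f → totalVolume (𝓡∂ k) (f ∘ φ) ≤ totalVolume (𝓡∂ k) f := by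
    intro φ f hφ hf
    have h := Measure.le_iff'.1 (vol_comp_le g hφ hf) univ
    rwa [Measure.map_apply φ.symm.measurable MeasurableSet.univ] at h
  refine le_antisymm (key hφ hf) ?_
  have h := key (inv_mem hφ) hfφ
  have hinv : (f ∘ φ) ∘ (φ⁻¹ : M ≃ₜ M) = f :=
    funext fun x => congrArg f (φ.apply_symm_apply x)
  rwa [hinv] at h

/-- The volume of a Lipschitz map on a compact manifold is finite: the chart densities are locally
bounded, and finitely many small chart pieces dominate the volume measure. -/
theorem totalVolume_lt_top [CompactSpace M] [SecondCountableTopology M] (g : RiemMetric k M)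
    {f : M → EuclideanSpace ℝ (Fin m)} (hf : MemW1Inf (𝓡∂ k) f) :
    totalVolume (𝓡∂ k) f < ⊤ := by
  set b := pullbackEuclidean (𝓡∂ k) f with hb
  have hloc : ∀ q : M, ∃ N : Set M, IsOpen N ∧ q ∈ N ∧ N ⊆ (extChartAt (𝓡∂ k) q).source ∧
      chartVol (𝓡∂ k) b q N < ⊤ := by
    intro q
    obtain ⟨L, U, hU, hL⟩ := hf.exists_lipschitzOnWith_image q (mem_extChartAt_source q)
    set N := interior (U ∩ (extChartAt (𝓡∂ k) q).source ∩
      extChartAt (𝓡∂ k) q ⁻¹' Metric.ball (extChartAt (𝓡∂ k) q q) 1) with hN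
    have hNq : N ∈ 𝓝 q := interior_mem_nhds.2 <| Filter.inter_mem
      (Filter.inter_mem hU (extChartAt_source_mem_nhds q))
      ((continuousAt_extChartAt q).preimage_mem_nhds (Metric.ball_mem_nhds _ one_pos))
    have hNs : N ⊆ (extChartAt (𝓡∂ k) q).source := fun y hy => (interior_subset hy).1.2
    refine ⟨N, isOpen_interior, mem_of_mem_nhds hNq, hNs, ?_⟩
    rw [chartVol_pullbackEuclidean f q isOpen_interior.measurableSet hNs]
    have hLN := hL N fun y hy => (interior_subset hy).1.1
    have h0 := volume_image_sdiff_interior q isOpen_interior hNs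
    set W := extChartAt (𝓡∂ k) q '' N with hW
    have hWb : W ⊆ Metric.ball (extChartAt (𝓡∂ k) q q) 1 := by
      rintro _ ⟨y, hy, rfl⟩
      exact (interior_subset hy).2
    have hae : interior W =ᵐ[volume] W := by
      refine Filter.EventuallyLE.antisymm (LE.le.eventuallyLE interior_subset) ?_
      exact ae_le_set.2 h0
    rw [← setLIntegral_congr hae]
    refine (setLIntegral_mono' isOpen_interior.measurableSet fun y hy =>
      areaDensity_le_of_lipschitzOnWith hLN hy).trans_lt ?_
    rw [setLIntegral_const]
    exact ENNReal.mul_lt_top ENNReal.ofReal_lt_top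
      ((measure_mono (interior_subset.trans hWb)).trans_lt measure_ball_lt_top)
  choose N hNo hqN hNs hfin using hloc
  obtain ⟨t, ht⟩ := isCompact_univ.elim_finite_subcover N hNo fun q _ => mem_iUnion.2 ⟨q, hqN q⟩
  have hle : vol (𝓡∂ k) b ≤ ∑ q ∈ t, (chartVol (𝓡∂ k) b q).restrict (N q) := by
    refine iSup_le fun p => measure_le_of_locally_le (chartVol_compl_source _ p) fun x hx => ?_
    obtain ⟨q, hqt, hxq⟩ := mem_iUnion₂.1 (ht (mem_univ x))
    obtain ⟨U, hU, h⟩ :=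
      exists_nhds_chartVol_comp_le (p := p) (q := q) g (one_mem (Diff g)) hf hx (hNs q hxq)
    refine ⟨U ∩ N q, Filter.inter_mem hU ((hNo q).mem_nhds hxq), fun A hA hAm => ?_⟩
    calc chartVol (𝓡∂ k) b p A ≤ chartVol (𝓡∂ k) b q A := by
          have h' := h A (hA.trans inter_subset_left) hAm
          have h1 : ⇑(1 : M ≃ₜ M) = id := rfl
          rw [h1, image_id] at h'
          exact h'
      _ = (chartVol (𝓡∂ k) b q).restrict (N q) A :=
          (Measure.restrict_eq_self _ (hA.trans inter_subset_right)).symm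
      _ ≤ (∑ q ∈ t, (chartVol (𝓡∂ k) b q).restrict (N q)) A := by
          rw [Measure.finsetSum_apply]
          exact Finset.single_le_sum
            (f := fun q => (chartVol (𝓡∂ k) b q).restrict (N q) A) (fun _ _ => zero_le) hqt
  refine (Measure.le_iff'.1 hle univ).trans_lt ?_
  rw [Measure.finsetSum_apply]
  refine ENNReal.sum_lt_top.2 fun q _ => ?_
  rw [Measure.restrict_apply_univ]
  exact hfin q

end LocalComparison

section MetricComparison

variable {k : ℕ} [NeZero k] {M : Type*} [TopologicalSpace M]
  [ChartedSpace (EuclideanHalfSpace k) M] [IsManifold (𝓡∂ k) ∞ M] [MeasurableSpace M]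
  [BorelSpace M] {m : ℕ}

theorem vol_le_of_ae_dP_lt (g : RiemMetric k M) {b c : FormField (𝓡∂ k) M} {s : ℝ}
    (h : ∀ᵐ x ∂vol (𝓡∂ k) g.form, dP (tangentBasis (𝓡∂ k) x) (b x) (c x) < ENNReal.ofReal s) :
    vol (𝓡∂ k) c ≤ ENNReal.ofReal (Real.exp (√k * s / 2)) • vol (𝓡∂ k) b ∧
      vol (𝓡∂ k) b ≤ ENNReal.ofReal (Real.exp (√k * s / 2)) • vol (𝓡∂ k) c := by
  have hsqrt : ∀ {u v : ℝ}, u ≤ Real.exp (√k * s) * v →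
      ENNReal.ofReal √u ≤ ENNReal.ofReal (Real.exp (√k * s / 2)) * ENNReal.ofReal √v := by
    intro u v huv
    rw [← ENNReal.ofReal_mul (Real.exp_nonneg _), Real.exp_half,
      ← Real.sqrt_mul (Real.exp_nonneg _)]
    exact ENNReal.ofReal_le_ofReal (Real.sqrt_le_sqrt huv)
  have key : ∀ {b c : FormField (𝓡∂ k) M},
      (∀ p, ∀ᵐ y ∂volume.restrict (extChartAt (𝓡∂ k) p).target,
        (chartGram (𝓡∂ k) c p y).det ≤ Real.exp (√k * s) * (chartGram (𝓡∂ k) b p y).det) →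
      vol (𝓡∂ k) c ≤ ENNReal.ofReal (Real.exp (√k * s / 2)) • vol (𝓡∂ k) b := by
    intro b c hbc
    refine iSup_le fun p => Measure.le_iff.2 fun A hA => ?_
    rw [Measure.smul_apply, smul_eq_mul]
    refine le_trans ?_ (mul_le_mul_right
      (Measure.le_iff'.1 (le_iSup (chartVol (𝓡∂ k) b) p) A) _)
    rw [chartVol_apply measurableSet_range_halfSpace _ p hA,
      chartVol_apply measurableSet_range_halfSpace _ p hA,
      ← lintegral_const_mul' _ _ ENNReal.ofReal_ne_top]
    refine lintegral_mono_ae ?_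
    filter_upwards [ae_restrict_of_ae_restrict_of_subset inter_subset_left (hbc p)] with y hy
    exact hsqrt hy
  have hdet := fun p => g.ae_extChartAt_of_ae_vol h p
  constructor <;> refine key fun p => ?_ <;> filter_upwards [hdet p] with y hy
  · have h' := (det_gram_le_of_dP_lt _ (chartFrame (𝓡∂ k) p y) hy).1
    rw [Fintype.card_fin] at h'
    exact h'
  · have h' := (det_gram_le_of_dP_lt _ (chartFrame (𝓡∂ k) p y) hy).2
    rw [Fintype.card_fin] at h'
    exact h'

theorem totalVolume_le_of_dImm_lt (g : RiemMetric k M) {f₁ f₂ : M → EuclideanSpace ℝ (Fin m)}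
    {s : ℝ} (h : dImm (𝓡∂ k) g.form f₁ f₂ < ENNReal.ofReal s) :
    totalVolume (𝓡∂ k) f₂ ≤
        ENNReal.ofReal (Real.exp (√k * s / 2)) * totalVolume (𝓡∂ k) f₁ ∧
      totalVolume (𝓡∂ k) f₁ ≤
        ENNReal.ofReal (Real.exp (√k * s / 2)) * totalVolume (𝓡∂ k) f₂ := by
  have h1 : dForms (𝓡∂ k) g.form (pullbackEuclidean (𝓡∂ k) f₁) (pullbackEuclidean (𝓡∂ k) f₂) <
      ENNReal.ofReal s := (le_add_self.trans le_self_add).trans_lt h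
  have h2 := vol_le_of_ae_dP_lt g
    ((ENNReal.ae_le_essSup _).mono fun x hx => hx.trans_lt h1)
  exact ⟨Measure.le_iff'.1 h2.1 univ, Measure.le_iff'.1 h2.2 univ⟩

end MetricComparison

/-! ### The volume on shape space -/

theorem abs_sub_le_of_le_exp_mul {a b u : ℝ} (ha : 0 ≤ a) (hu : 0 ≤ u)
    (hba : b ≤ Real.exp (u / 2) * a) (hab : a ≤ Real.exp (u / 2) * b) :
    |b - a| ≤ a * Real.exp u * u := by
  have h1 : 1 ≤ Real.exp (u / 2) := Real.one_le_exp (by positivity)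
  have h2 : Real.exp u = Real.exp (u / 2) * Real.exp (u / 2) := by rw [← Real.exp_add]; ring_nf
  have h3 : 1 - u / 2 ≤ Real.exp (-(u / 2)) := by
    have := Real.add_one_le_exp (-(u / 2))
    linarith
  have h4 : Real.exp (u / 2) * Real.exp (-(u / 2)) = 1 := by rw [← Real.exp_add]; simp
  have h5 : Real.exp (u / 2) - 1 ≤ Real.exp (u / 2) * (u / 2) := by nlinarith
  have h6 : Real.exp (-(u / 2)) * a ≤ b := by
    have := mul_le_mul_of_nonneg_left hab (Real.exp_nonneg (-(u / 2)))
    rwa [← mul_assoc, mul_comm (Real.exp (-(u / 2))) (Real.exp (u / 2)), h4, one_mul] at this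
  have h7 : u / 2 ≤ Real.exp (u / 2) * (u / 2) := le_mul_of_one_le_left (by positivity) h1
  have h8 : Real.exp (u / 2) * (u / 2) ≤ Real.exp u * u := by
    rw [h2]
    have : Real.exp (u / 2) * 1 ≤ Real.exp (u / 2) * Real.exp (u / 2) :=
      mul_le_mul_of_nonneg_left h1 (Real.exp_nonneg _)
    exact mul_le_mul (by linarith) (by linarith) (by positivity) (by positivity)
  have h9 := mul_le_mul_of_nonneg_left (h5.trans h8) ha
  have h10 := mul_le_mul_of_nonneg_left (h7.trans h8) ha
  have h11 := mul_le_mul_of_nonneg_right h3 ha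
  rw [abs_le]
  constructor <;> nlinarith

theorem secondCountableTopology_of_compact (k : ℕ) [NeZero k] (M : Type*) [TopologicalSpace M]
    [ChartedSpace (EuclideanHalfSpace k) M] [CompactSpace M] : SecondCountableTopology M := by
  have : SecondCountableTopology (EuclideanHalfSpace k) :=
    inferInstanceAs (SecondCountableTopology {x : EuclideanSpace ℝ (Fin k) // 0 ≤ x 0})
  exact ChartedSpace.secondCountable_of_sigmaCompact (EuclideanHalfSpace k) M

section Shape

variable {k : ℕ} [NeZero k] {M : Type*} [TopologicalSpace M]
  [ChartedSpace (EuclideanHalfSpace k) M] [IsManifold (𝓡∂ k) ∞ M] [MeasurableSpace M]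
  [BorelSpace M] [T2Space M] [CompactSpace M] (g : RiemMetric k M) {m : ℕ}

/-- By invariance, the pushforward of the volume is the volume of any representative. -/
theorem shapeVolume_proj (f : StrongImm g m) :
    shapeVolume g m (proj g m f) = (totalVolume (𝓡∂ k) f.1 : EReal) := by
  have := secondCountableTopology_of_compact k M
  refine le_antisymm (iInf₂_le f (show f ∈ proj g m ⁻¹' {proj g m f} from rfl))
    (le_iInf₂ fun f' hf' => ?_)
  obtain ⟨φ, hφ, h⟩ := Quotient.exact (hf' : proj g m f' = proj g m f)
  have hf₁ := f.2.1.1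
  rw [h] at hf₁ ⊢
  rw [totalVolume_comp g hφ f'.2.1.1 hf₁]
  exact le_rfl

theorem exists_shapeVolume_eq (x : Shape g m) :
    ∃ f : StrongImm g m, proj g m f = x ∧ totalVolume (𝓡∂ k) f.1 ≠ ⊤ ∧
      shapeVolume g m x = (totalVolume (𝓡∂ k) f.1 : EReal) := by
  have := secondCountableTopology_of_compact k M
  obtain ⟨f, rfl⟩ := Quotient.exists_rep x
  exact ⟨f, rfl, (totalVolume_lt_top g f.2.1.1).ne, shapeVolume_proj g f⟩

theorem shapeVolume_toReal_le_of_dShape_lt {x y : Shape g m} {s : ℝ}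
    (h : dShape g m x y < ENNReal.ofReal s) :
    (shapeVolume g m y).toReal ≤ Real.exp (√k * s / 2) * (shapeVolume g m x).toReal ∧
      (shapeVolume g m x).toReal ≤ Real.exp (√k * s / 2) * (shapeVolume g m y).toReal := by
  have := secondCountableTopology_of_compact k M
  simp only [dShape, iInf_lt_iff] at h
  obtain ⟨f₁, rfl, f₂, rfl, h⟩ := h
  have h1 := totalVolume_le_of_dImm_lt g (le_self_add.trans_lt h)
  have hfin₁ := (totalVolume_lt_top g f₁.2.1.1).ne
  have hfin₂ := (totalVolume_lt_top g f₂.2.1.1).ne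
  rw [shapeVolume_proj, shapeVolume_proj, EReal.toReal_coe_ennreal, EReal.toReal_coe_ennreal]
  have hmul : ∀ {a b : ℝ≥0∞}, b ≠ ⊤ → a ≤ ENNReal.ofReal (Real.exp (√k * s / 2)) * b →
      a.toReal ≤ Real.exp (√k * s / 2) * b.toReal := fun hb hab => by
    have := ENNReal.toReal_mono (ENNReal.mul_ne_top ENNReal.ofReal_ne_top hb) hab
    rwa [ENNReal.toReal_mul, ENNReal.toReal_ofReal (Real.exp_nonneg _)] at this
  exact ⟨hmul hfin₁ h1.1, hmul hfin₂ h1.2⟩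

theorem shapeVolume_toReal_nonneg (x : Shape g m) : 0 ≤ (shapeVolume g m x).toReal := by
  obtain ⟨f, -, -, h⟩ := exists_shapeVolume_eq g x
  rw [h, EReal.toReal_coe_ennreal]
  exact ENNReal.toReal_nonneg

theorem abs_shapeVolume_sub_le {x y : Shape g m} {t : ℝ≥0} (h : dShape g m x y ≤ t) :
    |(shapeVolume g m y).toReal - (shapeVolume g m x).toReal| ≤
      (shapeVolume g m x).toReal * Real.exp (√(k : ℝ) * t) * (√(k : ℝ) * t) := by
  -- The infimum that defines `dShape` need not be attained, so that the estimate holds for all `s >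
  -- t` first, and for `t` by continuity.
  have hs : ∀ s ∈ Ioi (t : ℝ), dShape g m x y < ENNReal.ofReal s := fun s hs =>
    h.trans_lt (by rw [← ENNReal.ofReal_coe_nnreal]; exact (ENNReal.ofReal_lt_ofReal_iff
      (t.2.trans_lt hs)).2 hs)
  have hlim : ∀ c : ℝ, Filter.Tendsto (fun s : ℝ => Real.exp (√k * s / 2) * c) (𝓝[>] (t : ℝ))
      (𝓝 (Real.exp (√k * t / 2) * c)) := fun c =>
    (Continuous.tendsto (by fun_prop) _).mono_left nhdsWithin_le_nhds
  refine abs_sub_le_of_le_exp_mul (shapeVolume_toReal_nonneg g x) (by positivity)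
    (ge_of_tendsto (hlim _) ?_) (ge_of_tendsto (hlim _) ?_) <;>
  filter_upwards [self_mem_nhdsWithin] with s hst
  exacts [(shapeVolume_toReal_le_of_dShape_lt g (hs s hst)).1,
    (shapeVolume_toReal_le_of_dShape_lt g (hs s hst)).2]

theorem isLocallyLipschitz_shapeVolume :
    IsLocallyLipschitz (dShape g m) fun y => (shapeVolume g m y).toReal := by
  intro x
  -- On the unit ball around `x` the volume is bounded by `C`. This settles pairs of points at
  -- distance at least `1`; all other pairs are covered by the modulus of continuity.
  set C : ℝ := Real.exp (√k * 1 / 2) * (shapeVolume g m x).toReal with hC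
  have hC0 : 0 ≤ C := mul_nonneg (Real.exp_nonneg _) (shapeVolume_toReal_nonneg g x)
  have hle : ∀ y, dShape g m x y < 1 → (shapeVolume g m y).toReal ≤ C := fun y hy =>
    (shapeVolume_toReal_le_of_dShape_lt g (by rwa [ENNReal.ofReal_one])).1
  set L : ℝ := C * (1 + Real.exp √k * √k) with hL
  have hCL : C ≤ L := le_mul_of_one_le_right hC0 (le_add_of_nonneg_right (by positivity))
  refine ⟨1, one_pos, L.toNNReal, fun y z hy hz => ?_⟩
  have hy0 := shapeVolume_toReal_nonneg g y
  have hz0 := shapeVolume_toReal_nonneg g z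
  rcases le_or_gt 1 (dShape g m y z) with h1 | h1
  · calc ENNReal.ofReal |(shapeVolume g m y).toReal - (shapeVolume g m z).toReal|
        ≤ ENNReal.ofReal L := ENNReal.ofReal_le_ofReal <| by
          rw [abs_le]
          constructor <;> linarith [hle y hy, hle z hz]
      _ = L.toNNReal * 1 := by rw [mul_one]; rfl
      _ ≤ L.toNNReal * dShape g m y z := mul_le_mul_right h1 _
  · lift dShape g m y z to ℝ≥0 using (h1.trans_le le_top).ne with t ht
    have ht1 : (t : ℝ) ≤ 1 := by exact_mod_cast h1.le
    have h := abs_shapeVolume_sub_le g (x := y) (y := z) ht.symm.le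
    have hL' : (L.toNNReal : ℝ≥0∞) * t = ENNReal.ofReal (L * t) := by
      rw [ENNReal.ofReal_mul (hC0.trans hCL), ENNReal.ofReal_coe_nnreal]
      rfl
    rw [hL', abs_sub_comm]
    refine ENNReal.ofReal_le_ofReal (h.trans ?_)
    calc (shapeVolume g m y).toReal * Real.exp (√k * t) * (√k * t)
        ≤ C * Real.exp √k * (√k * t) := by
          gcongr
          · exact hle y hy
          · exact mul_le_of_le_one_right (Real.sqrt_nonneg _) ht1
      _ = C * (Real.exp √k * √k) * t := by ring
      _ ≤ L * t := by
          rw [hL]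
          gcongr
          linarith

end Shape

end ShapeSpace

theorem mainTheorem6 {k : ℕ} [NeZero k] (M : Type*) [TopologicalSpace M] [T2Space M]
    [CompactSpace M] [ChartedSpace (EuclideanHalfSpace k) M] [IsManifold (𝓡∂ k) ∞ M]
    [MeasurableSpace M] [BorelSpace M] (g : ShapeSpace.RiemMetric k M) (m : ℕ) :
    (∀ x : ShapeSpace.Shape g m,
      ShapeSpace.shapeVolume g m x ≠ ⊤ ∧ ShapeSpace.shapeVolume g m x ≠ ⊥) ∧
    (∀ (x : ShapeSpace.Shape g m) (t : ℝ≥0),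
      ShapeSpace.modulusOfContinuity (ShapeSpace.dShape g m)
          (fun y => (ShapeSpace.shapeVolume g m y).toReal) x t ≤
        ENNReal.ofReal ((ShapeSpace.shapeVolume g m x).toReal *
          Real.exp (√(k : ℝ) * (t : ℝ)) * (√(k : ℝ) * (t : ℝ)))) ∧
    ShapeSpace.IsLocallyLipschitz (ShapeSpace.dShape g m)
      (fun y => (ShapeSpace.shapeVolume g m y).toReal) := by
  refine ⟨fun x => ?_, fun x t => ?_, ShapeSpace.isLocallyLipschitz_shapeVolume g⟩
  · obtain ⟨f, -, hfin, h⟩ := ShapeSpace.exists_shapeVolume_eq g x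
    rw [h]
    exact ⟨by simpa using hfin, by simp⟩
  · exact iSup₂_le fun y hy => ENNReal.ofReal_le_ofReal (ShapeSpace.abs_shapeVolume_sub_le g hy)
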